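/- An argumentation framework (AF) is a finite directed graph $F=(A,R)$ with a non-empty set $A$ of arguments and a set $R\subseteq A\times A$ of attacks. A set $E\subseteq A$ is conflict-free if $(E\times E)\cap R=\emptyset$, and admissible if it is conflict-free and for all $a\in E$ and $(b,a)\in R$ there is $c\in E$ with $(c,b)\in R$. Let $E^+_R=E\cup\{a\mid (b,a)\in R \text{ for some } b\in E\}$. The set $E$ is a *preferred* extension of $F$ if it is admissible and no admissible set $E'$ satisfies $E\subsetneq E'$; it is a *semi-stable* extension if it is admissible and no admissible $E'$ satisfies $E^+_R\subsetneq (E')^+_R$; it is a *stage* extension if it is conflict-free and no conflict-free $E'$ satisfies $E^+_R\subsetneq (E')^+_R$. For $\sigma\in\{\text{preferred},\text{semi-stable},\text{stage}\}$, an argument is a $\sigma$-facet of $F$ if it belongs to some, but not to all, $\sigma$-extensions of $F$. Let $\Sigma_0^P=\mathrm{P}$, $\Sigma_{i+1}^P=\mathrm{NP}^{\Sigma_i^P}$ (polynomial-time nondeterministic oracle Turing machines with an oracle from $\Sigma_i^P$), let $\Pi_i^P$ be the class of complements of languages in $\Sigma_i^P$, and let $\mathrm{DP}_i=\{L_1\cap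 L_2\mid L_1\in\Sigma_i^P,\ L_2\in\Pi_i^P\}$. **Theorem.** For each $\sigma\in\{\text{preferred},\text{semi-stable},\text{stage}\}$, the following problem is in $\mathrm{DP}_2$: given an AF $F$ (by its adjacency matrix) and a natural number $k$ (in binary), decide whether $F$ has exactly $k$ $\sigma$-facets. -/

import Mathlib

/-! ### Argumentation frameworks -/

namespace Argumentation

/-- An argumentation framework with set of arguments `A` is a directed graph on `A`:
`F.Adj a b` says that `a` attacks `b`. -/
abbrev AF (A : Type*) := Digraph A

variable {A : Type*}

/-- No argument of `E` attacks an argument of `E`. -/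
def ConflictFree (F : AF A) (E : Set A) : Prop :=
  ∀ a ∈ E, ∀ b ∈ E, ¬ F.Adj a b

/-- `a` is defended by `E`: every attacker of `a` is attacked by an element of `E`. -/
def Defended (F : AF A) (E : Set A) (a : A) : Prop :=
  ∀ b, F.Adj b a → ∃ c ∈ E, F.Adj c b

def Admissible (F : AF A) (E : Set A) : Prop :=
  ConflictFree F E ∧ ∀ a ∈ E, Defended F E a

/-- The range `E ∪ {a | some b ∈ E attacks a}` of `E`. -/
def rangeOf (F : AF A) (E : Set A) : Set A :=
  E ∪ {a | ∃ b ∈ E, F.Adj b a}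

def Preferred (F : AF A) (E : Set A) : Prop :=
  Admissible F E ∧ ¬ ∃ E' : Set A, Admissible F E' ∧ E ⊂ E'

def SemiStable (F : AF A) (E : Set A) : Prop :=
  Admissible F E ∧ ¬ ∃ E' : Set A, Admissible F E' ∧ rangeOf F E ⊂ rangeOf F E'

def Stage (F : AF A) (E : Set A) : Prop :=
  ConflictFree F E ∧ ¬ ∃ E' : Set A, ConflictFree F E' ∧ rangeOf F E ⊂ rangeOf F E'

/-- The three semantics under consideration. -/
inductive Semantics
  | preferred
  | semiStable
  | stage

/-- The set of all extensions of `F` under a semantics. -/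
def Semantics.extensions (sem : Semantics) (F : AF A) : Set (Set A) :=
  match sem with
  | .preferred => {E | Preferred F E}
  | .semiStable => {E | SemiStable F E}
  | .stage => {E | Stage F E}

/-- The credulously accepted arguments. -/
def cred (sem : Semantics) (F : AF A) : Set A :=
  {a | ∃ E ∈ sem.extensions F, a ∈ E}

/-- The skeptically accepted arguments. -/
def skep (sem : Semantics) (F : AF A) : Set A :=
  {a | ∀ E ∈ sem.extensions F, a ∈ E}

/-- The facets: arguments that are credulously but not skeptically accepted. -/
def facets (sem : Semantics) (F : AF A) : Set A :=
  cred sem F \ skep sem F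

end Argumentation

/-! ### Complexity classes, for languages over the alphabet `{false, true}` -/

namespace Complexity

/-- A decision problem: a set of bit strings. -/
abbrev Lang := Set (List Bool)

/-- Deterministic polynomial time: the characteristic function is computed by a Turing machine
in polynomial time. -/
def PTIME : Set Lang :=
  {L | ∃ f : List Bool → Bool, (∀ w, w ∈ L ↔ f w = true) ∧
    Nonempty (Turing.TM2ComputableInPolyTime (id : List Bool → List Bool)
      Computability.encodeBool f)}

/-- A nondeterministic oracle Turing machine with finitely many stacks (half tapes). The programs
are those of `Turing.TM2`. Nondeterminism is given by a pair `prog false`, `prog true` of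
transition functions, one of which is chosen freely at each step. At a label `l` with
`query l = some next`, the machine asks whether the word on its query stack belongs to the oracle,
the query stack is erased, and the machine continues at `next answer`. -/
structure OracleNTM where
  /-- the stacks -/
  {K : Type}
  [decEqK : DecidableEq K]
  [finK : Fintype K]
  /-- the alphabet of each stack -/
  Γ : K → Type
  [finΓ : ∀ k, Fintype (Γ k)]
  /-- the input stack -/
  inStack : K
  /-- the query stack -/
  queryStack : K
  inAlphabet : Γ inStack ≃ Bool
  queryAlphabet : Γ queryStack ≃ Bool
  /-- the labels (control states) -/
  Λ : Type
  [finΛ : Fintype Λ]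
  main : Λ
  /-- the finite internal memory -/
  σ : Type
  [finσ : Fintype σ]
  initialState : σ
  prog : Bool → Λ → Turing.TM2.Stmt Γ Λ σ
  query : Λ → Option (Bool → Λ)
  /-- whether the machine accepts if it halts with the given internal memory -/
  accept : σ → Bool

namespace OracleNTM

attribute [instance] OracleNTM.decEqK OracleNTM.finK OracleNTM.finΓ OracleNTM.finΛ OracleNTM.finσ

variable (M : OracleNTM)

/-- Configurations; the machine has halted iff the label is `none`. -/
abbrev Cfg : Type := Turing.TM2.Cfg M.Γ M.Λ M.σ

/-- The initial configuration on input `w`: all stacks but the input stack are empty. -/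
def init (w : List Bool) : M.Cfg where
  l := some M.main
  var := M.initialState
  stk := Function.update (fun _ => []) M.inStack (w.map M.inAlphabet.symm)

open Classical in
/-- One step with oracle `O` and nondeterministic choice `c`. A halted machine stays put. -/
noncomputable def step (O : Lang) (c : Bool) : M.Cfg → M.Cfg
  | ⟨none, v, S⟩ => ⟨none, v, S⟩
  | ⟨some l, v, S⟩ =>
    match M.query l with
    | some next =>
      ⟨some (next (decide ((S M.queryStack).map M.queryAlphabet ∈ O))), v,
        Function.update S M.queryStack []⟩
    | none => Turing.TM2.stepAux (M.prog c l) v S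

/-- The configuration that is reached from `x` by following a sequence of choices. -/
noncomputable def run (O : Lang) (choices : List Bool) (x : M.Cfg) : M.Cfg :=
  choices.foldl (fun y c => M.step O c y) x

/-- With oracle `O`, the machine decides `L` within time `t`: on an input of length `n`, every
computation halts after at most `t n` steps, and the input is in `L` iff some computation halts
and accepts. -/
def DecidesInTime (O : Lang) (t : ℕ → ℕ) (L : Lang) : Prop :=
  ∀ w : List Bool,
    (∀ choices : List Bool, choices.length = t w.length →
      (M.run O choices (M.init w)).l = none) ∧
    (w ∈ L ↔ ∃ choices : List Bool,
      (M.run O choices (M.init w)).l = none ∧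
      M.accept (M.run O choices (M.init w)).var = true)

end OracleNTM

/-- Nondeterministic polynomial time with oracle `O`. -/
def NPWithOracle (O : Lang) : Set Lang :=
  {L | ∃ (M : OracleNTM) (p : Polynomial ℕ), M.DecidesInTime O (fun n => p.eval n) L}

/-- The levels `Σᵢ` of the polynomial hierarchy: `Σ₀ = P` and `Σᵢ₊₁ = NP^Σᵢ`. -/
def SigmaP : ℕ → Set Lang
  | 0 => PTIME
  | i + 1 => {L | ∃ O ∈ SigmaP i, L ∈ NPWithOracle O}

/-- The levels `Πᵢ` of the polynomial hierarchy: the complements of the languages in `Σᵢ`. -/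
def PiP (i : ℕ) : Set Lang :=
  {L | Lᶜ ∈ SigmaP i}

/-- The class of intersections of a language in `Σᵢ` and a language in `Πᵢ`. -/
def DP (i : ℕ) : Set Lang :=
  {L | ∃ L₁ ∈ SigmaP i, ∃ L₂ ∈ PiP i, L = L₁ ∩ L₂}

end Complexity

/-! ### The decision problem -/

namespace Argumentation

open Classical in
/-- The bit string for a framework `F` with arguments `0, …, n-1` and a number `k`: the number `n`
in unary, followed by a zero, the `n × n` adjacency matrix of `F` row by row, and the binary digits
of `k`, least significant first. -/
noncomputable def encodeInstance {n : ℕ} (F : AF (Fin n)) (k : ℕ) : List Bool :=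
  List.replicate n true ++ [false] ++
    (List.finRange n).flatMap (fun i => (List.finRange n).map fun j => decide (F.Adj i j)) ++
    Nat.bits k

/-- The problem: given a framework `F` with a non-empty finite set of arguments and a number `k`
(in binary), does `F` have exactly `k` facets? -/
def exactFacets (sem : Semantics) : Complexity.Lang :=
  {w | ∃ n : ℕ, 0 < n ∧ ∃ (F : AF (Fin n)) (k : ℕ),
    w = encodeInstance F k ∧ (facets sem F).ncard = k}

end Argumentation

/-! ### Guessing annotations before an oracle call -/

namespace Complexity

/-! Having exactly `k` facets means having at least `k` but not at least `k + 1` of them, so it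
suffices that `atLeastFacets sem d` lies in the second level for both `d` (`exactFacets_eq`,
`atLeastFacets_mem_SigmaP`).

A certificate for at least `k + d` facets is a set `S` of `k + d` arguments together with, for each
`i ∈ S`, an extension containing `i` and one avoiding `i`. A wrong certificate has a short
refutation: one of the proposed extensions with a visible defect (wrong about `i`, not
conflict-free, not defended) or with a better set beside it. All three semantics ask for maximality
of a measure, which makes this uniform (`mem_extensions_iff`, `forall_not_refutes_iff`). Thus the
problem has the form "some certificate has no refutation", with a polynomial-time test of
refutations.

At the level of machines, both rounds of guessing are done by the same small machine: it adds two
bits to every letter and hands the word to its oracle (`guess_mem_NPWithOracle`). This gives enough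
room: the `n` letters of the unary prefix carry `S` and later the refutation, and the `n * n`
letters of the matrix carry the proposed extensions. The test itself is a `Scanner`, which passes
once over the matrix with finite memory and a finite state for each column. Every scanner runs in
quadratic time (`result_mem_PTIME`), and the one used here is correct by `result_eq_false_iff`. -/

/-- The concatenation of a list of triples of bits. -/
def flattenTriples (l : List (Bool × Bool × Bool)) : List Bool :=
  l.flatMap fun t => [t.1, t.2.1, t.2.2]

@[simp] theorem flattenTriples_nil : flattenTriples [] = [] := rfl

@[simp] theorem flattenTriples_cons (t : Bool × Bool × Bool) (l : List (Bool × Bool × Bool)) :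
    flattenTriples (t :: l) = t.1 :: t.2.1 :: t.2.2 :: flattenTriples l := rfl

@[simp] theorem flattenTriples_append (l l' : List (Bool × Bool × Bool)) :
    flattenTriples (l ++ l') = flattenTriples l ++ flattenTriples l' := by
  simp [flattenTriples]

/-! ### The guessing machine. -/

namespace Guess

inductive Stack
  | input
  | query
  deriving DecidableEq

instance : Fintype Stack := ⟨{.input, .query}, by rintro ⟨⟩ <;> simp⟩

inductive Label
  | read
  | first
  | second
  | ask
  | done (answer : Bool)
  deriving DecidableEq, Fintype

open Turing.TM2.Stmt

/-- The program that copies the input to the query stack and adds two guessed bits after every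
letter. -/
def prog (s c : Bool) : Label → Turing.TM2.Stmt (fun _ : Stack => Bool) Label (Option Bool)
  | .read => pop .input (fun _ b => b) <| branch Option.isSome
      (push .query (fun v => v.getD false) <| goto fun _ => .first) (goto fun _ => .ask)
  -- The nondeterministic choice `c` is used only at `first` and `second`.
  | .first => push .query (fun _ => c) <| goto fun _ => .second
  | .second => push .query (fun _ => c) <| goto fun _ => .read
  -- Never executed: `query` intercepts this label.
  | .ask => halt
  | .done a => load (fun _ => some (a == s)) halt

/-- The machine annotates its input with guessed bits, asks the oracle, and accepts if the answer
is `s`. -/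
def machine (s : Bool) : OracleNTM where
  K := Stack
  Γ := fun _ => Bool
  inStack := .input
  queryStack := .query
  inAlphabet := Equiv.refl _
  queryAlphabet := Equiv.refl _
  Λ := Label
  main := .read
  σ := Option Bool
  initialState := none
  prog := prog s
  query
    | .ask => some .done
    | _ => none
  accept v := v == some true

/-- The stacks, given their contents. -/
def contents (w x : List Bool) : Stack → List Bool
  | .input => w
  | .query => x

@[simp] theorem contents_input (w x : List Bool) : contents w x .input = w := rfl

@[simp] theorem contents_query (w x : List Bool) : contents w x .query = x := rfl

@[simp] theorem update_contents_input (w x y : List Bool) :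
    Function.update (contents w x) .input y = contents y x := by
  funext k; cases k <;> rfl

@[simp] theorem update_contents_query (w x y : List Bool) :
    Function.update (contents w x) .query y = contents w y := by
  funext k; cases k <;> rfl

variable (O : Lang) (s : Bool)

/-- Configurations, without reference to the machine. -/
abbrev PlainCfg : Type := Turing.TM2.Cfg (fun _ : Stack => Bool) Label (Option Bool)

/-- A configuration of the machine. -/
def cfg (l : Option Label) (v : Option Bool) (w x : List Bool) : (machine s).Cfg :=
  (⟨l, v, contents w x⟩ : PlainCfg)

theorem init_eq (w : List Bool) : (machine s).init w = cfg s (some .read) none w [] := by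
  have h : (fun _ : Stack => ([] : List Bool)) = contents [] [] := by
    funext k; cases k <;> rfl
  unfold OracleNTM.init cfg machine
  congr 1
  simp only [Equiv.refl_symm, Equiv.coe_refl, List.map_id]
  exact (congrArg (fun S => Function.update S Stack.input w) h).trans (update_contents_input _ _ _)

theorem step_read_cons (c b : Bool) (v : Option Bool) (w x : List Bool) :
    (machine s).step O c (cfg s (some .read) v (b :: w) x) =
      cfg s (some .first) (some b) w (b :: x) := by
  show (Turing.TM2.stepAux (prog s c .read) v (contents (b :: w) x) : PlainCfg) =
    ⟨some .first, some b, contents w (b :: x)⟩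
  simp [prog]

theorem step_read_nil (c : Bool) (v : Option Bool) (x : List Bool) :
    (machine s).step O c (cfg s (some .read) v [] x) = cfg s (some .ask) none [] x := by
  show (Turing.TM2.stepAux (prog s c .read) v (contents [] x) : PlainCfg) =
    ⟨some .ask, none, contents [] x⟩
  simp [prog]

theorem step_first (c : Bool) (v : Option Bool) (w x : List Bool) :
    (machine s).step O c (cfg s (some .first) v w x) = cfg s (some .second) v w (c :: x) := by
  show (Turing.TM2.stepAux (prog s c .first) v (contents w x) : PlainCfg) =
    ⟨some .second, v, contents w (c :: x)⟩
  simp [prog]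

theorem step_second (c : Bool) (v : Option Bool) (w x : List Bool) :
    (machine s).step O c (cfg s (some .second) v w x) = cfg s (some .read) v w (c :: x) := by
  show (Turing.TM2.stepAux (prog s c .second) v (contents w x) : PlainCfg) =
    ⟨some .read, v, contents w (c :: x)⟩
  simp [prog]

open Classical in
theorem step_ask (c : Bool) (v : Option Bool) (w x : List Bool) :
    (machine s).step O c (cfg s (some .ask) v w x) =
      cfg s (some (.done (decide (x ∈ O)))) v w [] := by
  show (⟨some (.done (decide (x.map (Equiv.refl Bool) ∈ O))), v,
    Function.update (contents w x) .query []⟩ : PlainCfg) = ⟨_, _, contents w []⟩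
  rw [update_contents_query, Equiv.coe_refl, List.map_id]

theorem step_done (c a : Bool) (v : Option Bool) (w x : List Bool) :
    (machine s).step O c (cfg s (some (.done a)) v w x) = cfg s none (some (a == s)) w x := by
  show (Turing.TM2.stepAux (prog s c (.done a)) v (contents w x) : PlainCfg) =
    ⟨none, some (a == s), contents w x⟩
  simp [prog]

end Guess

namespace OracleNTM

variable (M : OracleNTM) (O : Lang)

@[simp] theorem run_nil (x : M.Cfg) : M.run O [] x = x := rfl

@[simp] theorem run_cons (c : Bool) (cs : List Bool) (x : M.Cfg) :
    M.run O (c :: cs) x = M.run O cs (M.step O c x) := rfl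

theorem run_append (cs cs' : List Bool) (x : M.Cfg) :
    M.run O (cs ++ cs') x = M.run O cs' (M.run O cs x) := by
  simp [run]

theorem run_of_halted (cs : List Bool) (x : M.Cfg) (hx : x.l = none) : M.run O cs x = x := by
  induction cs with
  | nil => rfl
  | cons c cs ih =>
    obtain ⟨l, v, S⟩ := x
    obtain rfl : l = none := hx
    simpa [step] using ih

end OracleNTM

namespace Guess

variable (O : Lang) (s : Bool)

-- Each letter takes three steps, the choices in the last two being its annotation; noticing the
-- end, asking and halting take three more. Surplus choices do not move a halted machine.
open Classical in
theorem exists_triples_of_run (w x cs : List Bool) (v : Option Bool)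
    (h : 3 * w.length + 3 ≤ cs.length) :
    ∃ l : List (Bool × Bool × Bool), l.map Prod.fst = w ∧
      (machine s).run O cs (cfg s (some .read) v w x) =
        cfg s none (some (decide ((flattenTriples l).reverse ++ x ∈ O) == s)) [] [] := by
  induction w generalizing x cs v with
  | nil =>
    obtain _ | ⟨c₁, _ | ⟨c₂, _ | ⟨c₃, cs⟩⟩⟩ := cs <;> simp at h
    refine ⟨[], rfl, ?_⟩
    simp only [OracleNTM.run_cons, step_read_nil, step_ask, step_done]
    exact OracleNTM.run_of_halted _ _ _ _ rfl
  | cons b w ih =>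
    obtain _ | ⟨c₁, _ | ⟨c₂, _ | ⟨c₃, cs⟩⟩⟩ := cs <;> simp at h
    obtain ⟨l, hl, hr⟩ := ih (c₃ :: c₂ :: b :: x) cs (some b) (by omega)
    refine ⟨(b, c₂, c₃) :: l, by simp [hl], ?_⟩
    simp only [OracleNTM.run_cons, step_read_cons, step_first, step_second, hr]
    simp

open Classical in
theorem exists_run_of_triples (l : List (Bool × Bool × Bool)) (x : List Bool) (v : Option Bool) :
    ∃ cs, (machine s).run O cs (cfg s (some .read) v (l.map Prod.fst) x) =
        cfg s none (some (decide ((flattenTriples l).reverse ++ x ∈ O) == s)) [] [] := by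
  induction l generalizing x v with
  | nil =>
    refine ⟨[false, false, false], ?_⟩
    simp only [OracleNTM.run_cons, List.map_nil, step_read_nil, step_ask, step_done]
    rfl
  | cons t l ih =>
    obtain ⟨b, c, d⟩ := t
    obtain ⟨cs, hr⟩ := ih (d :: c :: b :: x) (some b)
    refine ⟨false :: c :: d :: cs, ?_⟩
    simp only [OracleNTM.run_cons, List.map_cons, step_read_cons, step_first, step_second, hr]
    simp

end Guess

/-- Words that can be annotated with two bits per letter such that the annotated word, read
backwards, is or is not in the oracle, are recognized in nondeterministic polynomial time. -/
theorem guess_mem_NPWithOracle (O : Lang) (s : Bool) :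
    {w | ∃ l : List (Bool × Bool × Bool), l.map Prod.fst = w ∧
      ((flattenTriples l).reverse ∈ O ↔ s = true)} ∈ NPWithOracle O := by
  classical
  refine ⟨Guess.machine s, 3 * Polynomial.X + 3, fun w => ⟨fun cs hcs => ?_, ?_⟩⟩
  · obtain ⟨l, -, hr⟩ := Guess.exists_triples_of_run O s w [] cs none (by simp [hcs])
    rw [Guess.init_eq, hr]; rfl
  · have key (l : List (Bool × Bool × Bool)) :
        ((flattenTriples l).reverse ∈ O ↔ s = true) ↔
        (Guess.machine s).accept
          (some (decide ((flattenTriples l).reverse ++ [] ∈ O) == s)) = true := by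
      simp only [Guess.machine, List.append_nil]
      by_cases h : (flattenTriples l).reverse ∈ O <;> cases s <;> simp [h]
    constructor
    · rintro ⟨l, rfl, hl⟩
      obtain ⟨cs, hr⟩ := Guess.exists_run_of_triples O s l [] none
      refine ⟨cs, ?_⟩
      rw [Guess.init_eq, hr]
      exact ⟨rfl, (key l).1 hl⟩
    · rintro ⟨cs, hn, ha⟩
      -- An accepting run may be given by a short list of choices; padding makes the list long
      -- enough without changing the halted configuration.
      obtain ⟨l, hl, hr⟩ := Guess.exists_triples_of_run O s w []
        (cs ++ List.replicate (3 * w.length + 3) false) none (by simp)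
      rw [← Guess.init_eq, OracleNTM.run_append, OracleNTM.run_of_halted _ _ _ _ hn] at hr
      rw [hr] at ha
      exact ⟨l, hl, (key l).2 ha⟩

end Complexity

/-! ### A machine that scans a matrix row by row -/

namespace Complexity

/-- Nine letters that are read at once; `none` stands for the end of the word. -/
abbrev Buffer : Type := Fin 9 → Option Bool

/-- The first nine letters of a word. -/
def readBuffer (x : List Bool) : Buffer := fun i => x[(i : ℕ)]?

section Scan

variable {Q R : Type} (entry : R → Q → Buffer → R × Q) (row : R → Option Q → R)

/-- Scan one row: returns the global state, the states of the columns and the remaining word. -/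
def scanRow : R → List Q → List Bool → R × List Q × List Bool
  | r, [], x => (r, [], x)
  | r, q :: qs, x =>
    ((scanRow (entry r q (readBuffer x)).1 qs (x.drop 9)).1,
      (entry r q (readBuffer x)).2 :: (scanRow (entry r q (readBuffer x)).1 qs (x.drop 9)).2.1,
      (scanRow (entry r q (readBuffer x)).1 qs (x.drop 9)).2.2)

/-- Scan the rows of the matrix. -/
def scanRows : List Q → R → List Q → List Bool → R × List Q × List Bool
  | [], r, qs, x => (r, qs, x)
  | c :: cs, r, qs, x =>
    scanRows cs (scanRow entry (row r (some c)) qs x).1 (scanRow entry (row r (some c)) qs x).2.1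
      (scanRow entry (row r (some c)) qs x).2.2

/-- Scan the rows of the matrix and the additional row. -/
def scanAll (cs : List Q) (r : R) (qs : List Q) (x : List Bool) : R × List Q × List Bool :=
  scanRow entry (row (scanRows entry row cs r qs x).1 none) (scanRows entry row cs r qs x).2.1
    (scanRows entry row cs r qs x).2.2

end Scan

/-- A finite automaton for scanning a square matrix row by row. It has a global state and one state
for every column. Entries are given by nine bits each. -/
structure Scanner where
  /-- states of a column -/
  Q : Type
  [finQ : Fintype Q]
  /-- global states -/
  R : Type
  [finR : Fintype R]
  /-- the initial state of a column -/
  initCol : Buffer → Q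
  initState : R
  /-- the transition at the beginning of a row. The argument is the initial state of the column
  with the same index; after the last row of the matrix, there is one more row, for which the
  argument is `none`. -/
  row : R → Option Q → R
  /-- the transition at an entry of the matrix -/
  entry : R → Q → Buffer → R × Q
  /-- acceptance, depending on whether the whole word has been read -/
  accept : R → Bool → Bool

namespace Scanner

attribute [instance] Scanner.finQ Scanner.finR

variable (P : Scanner)

/-- The initial states of the columns are given by the blocks up to the first one which has no one
at position two. -/
def splitPrefix (x : List Bool) : List P.Q × List Bool :=
  if x[2]? = some true then
    (P.initCol (readBuffer x) :: (splitPrefix (x.drop 9)).1, (splitPrefix (x.drop 9)).2)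
  -- The block of the separating zero is consumed as well.
  else ([], x.drop 9)
termination_by x.length
decreasing_by
  all_goals
    have : 2 < x.length := by
      by_contra h
      simp_all
    simp only [List.length_drop]
    omega

/-- The result of the scan of the word `x`. -/
def result (x : List Bool) : Bool :=
  let s := P.splitPrefix x
  let t := scanAll P.entry P.row s.1 P.initState s.1 s.2
  P.accept t.1 t.2.2.isEmpty

/-! ### A Turing machine that runs a scanner. -/

inductive Stack
  | input
  | cols
  | done
  | rows
  deriving DecidableEq

instance : Fintype Stack := ⟨{.input, .cols, .done, .rows}, by rintro ⟨⟩ <;> simp⟩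

inductive Label
  | readPrefix
  | spread
  | newRow
  | cell
  | restore
  | clear
  deriving DecidableEq

instance : Fintype Label :=
  ⟨{.readPrefix, .spread, .newRow, .cell, .restore, .clear}, by rintro ⟨⟩ <;> simp⟩

/-- The alphabets of the stacks. -/
def Alphabet : Stack → Type
  | .input => Bool
  | .cols => P.Q
  | .done => P.Q
  | .rows => P.Q

/-- The internal memory: the global state, the letters read last, the state of the present column,
and a bit that is used first for the last row and then for the result. -/
abbrev Memory : Type := P.R × Buffer × Option P.Q × Bool

open Turing.TM2.Stmt

/-- The statements of the machine. -/
abbrev Stmt : Type := Turing.TM2.Stmt P.Alphabet Label P.Memory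

/-- The configurations of the machine. -/
abbrev Cfg : Type := Turing.TM2.Cfg P.Alphabet Label P.Memory

/-- Pop a letter from the input and store it at position `i`. -/
def popInput (i : Fin 9) (q : P.Stmt) : P.Stmt :=
  pop .input (fun v b => (v.1, Function.update v.2.1 i b, v.2.2)) q

/-- Pop nine letters from the input. -/
def popBuffer (q : P.Stmt) : P.Stmt :=
  P.popInput 0 <| P.popInput 1 <| P.popInput 2 <| P.popInput 3 <| P.popInput 4 <| P.popInput 5 <|
    P.popInput 6 <| P.popInput 7 <| P.popInput 8 q

/-- Pop the state of a column. -/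
def popCol (q : P.Stmt) : P.Stmt :=
  pop .cols (fun v (c : Option P.Q) => (v.1, v.2.1, c, v.2.2.2)) q

def popDone (q : P.Stmt) : P.Stmt :=
  pop .done (fun v (c : Option P.Q) => (v.1, v.2.1, c, v.2.2.2)) q

def popRow (q : P.Stmt) : P.Stmt :=
  pop .rows (fun v (c : Option P.Q) => (v.1, v.2.1, c, v.2.2.2)) q

def pushInput (f : P.Memory → Bool) (q : P.Stmt) : P.Stmt := push .input f q

def pushCol (f : P.Memory → P.Q) (q : P.Stmt) : P.Stmt := push .cols f q

def pushDone (f : P.Memory → P.Q) (q : P.Stmt) : P.Stmt := push .done f q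

def pushRow (f : P.Memory → P.Q) (q : P.Stmt) : P.Stmt := push .rows f q

/-- The state of the present column. -/
def present (v : P.Memory) : P.Q := v.2.2.1.getD (P.initCol fun _ => none)

def startState : P.Memory := (P.initState, fun _ => none, none, false)

def prog : Label → P.Stmt
  | .readPrefix => P.popBuffer <| branch (fun v => v.2.1 2 == some true)
      (P.pushDone (fun v => P.initCol v.2.1) <| goto fun _ => .readPrefix) (goto fun _ => .spread)
  -- The prefix lies reversed on `done`; moving it restores the order and makes two copies, the
  -- columns and the labels of the rows.
  | .spread => P.popDone <| branch (fun v => v.2.2.1.isSome)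
      (P.pushCol P.present <| P.pushRow P.present <| goto fun _ => .spread)
      (goto fun _ => .newRow)
  -- An exhausted stack `rows` signals the additional row; the last bit of the memory records this
  -- for `restore`.
  | .newRow => P.popRow <|
      load (fun v => (P.row v.1 v.2.2.1, v.2.1, v.2.2.1, v.2.2.1.isNone)) <| goto fun _ => .cell
  | .cell => P.popCol <| branch (fun v => v.2.2.1.isSome)
      (P.popBuffer <| P.pushDone (fun v => (P.entry v.1 (P.present v) v.2.1).2) <|
        load (fun v => ((P.entry v.1 (P.present v) v.2.1).1, v.2)) <| goto fun _ => .cell)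
      (goto fun _ => .restore)
  | .restore => P.popDone <| branch (fun v => v.2.2.1.isSome)
      (P.pushCol P.present <| goto fun _ => .restore) <|
      branch (fun v => v.2.2.2)
        (peek .input (fun v (b : Option Bool) => (v.1, v.2.1, v.2.2.1, P.accept v.1 b.isNone)) <|
          goto fun _ => .clear)
        (goto fun _ => .newRow)
  -- The halting configuration demanded by `Turing.haltList` has the initial memory and no stack
  -- content except the output.
  | .clear => P.popInput 0 <| P.popCol <|
      branch (fun v => (v.2.1 0).isSome || v.2.2.1.isSome) (goto fun _ => .clear) <|
      P.pushInput (fun v => (v.2.2.2 : Bool)) <| load (fun _ => P.startState) halt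

/-- The stacks, given their contents. -/
def contents (x : List Bool) (a b c : List P.Q) : ∀ k, List (P.Alphabet k)
  | .input => x
  | .cols => a
  | .done => b
  | .rows => c

/-! ### Running time and output of the machine. -/

variable {P} (x y : List Bool) (a b c d : List P.Q) (v : P.Memory) (q : P.Stmt)

@[simp] theorem contents_input : P.contents x a b c .input = x := rfl

@[simp] theorem update_contents_input :
    Function.update (P.contents x a b c) .input y = P.contents y a b c := by
  funext k; cases k <;> rfl

@[simp] theorem update_contents_cols :
    Function.update (P.contents x a b c) .cols d = P.contents x d b c := by
  funext k; cases k <;> rfl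

@[simp] theorem update_contents_done :
    Function.update (P.contents x a b c) .done d = P.contents x a d c := by
  funext k; cases k <;> rfl

@[simp] theorem update_contents_rows :
    Function.update (P.contents x a b c) .rows d = P.contents x a b d := by
  funext k; cases k <;> rfl

@[simp] theorem readBuffer_apply (i : Fin 9) : readBuffer x i = x[(i : ℕ)]? := rfl

theorem stepAux_popInput (i : Fin 9) :
    Turing.TM2.stepAux (P.popInput i q) v (P.contents x a b c) =
      Turing.TM2.stepAux q (v.1, Function.update v.2.1 i x.head?, v.2.2)
        (P.contents x.tail a b c) := by
  exact congrArg (Turing.TM2.stepAux q _) (update_contents_input ..)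

theorem stepAux_popBuffer :
    Turing.TM2.stepAux (P.popBuffer q) v (P.contents x a b c) =
      Turing.TM2.stepAux q (v.1, readBuffer x, v.2.2) (P.contents (x.drop 9) a b c) := by
  simp only [popBuffer, stepAux_popInput]
  have hu (u : Buffer) : readBuffer x = Function.update (Function.update (Function.update
      (Function.update (Function.update (Function.update (Function.update (Function.update
      (Function.update u 0 x[0]?) 1 x[1]?) 2 x[2]?) 3 x[3]?) 4 x[4]?) 5 x[5]?) 6 x[6]?) 7 x[7]?)
      8 x[8]? := by
    funext i
    fin_cases i <;> simp [Function.update]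
  have hd : x.drop 9 = x.tail.tail.tail.tail.tail.tail.tail.tail.tail := by
    simp only [← List.drop_one, List.drop_drop]
  simp [hu v.2.1, hd, List.head?_eq_getElem?]

theorem stepAux_popCol :
    Turing.TM2.stepAux (P.popCol q) v (P.contents x a b c) =
      Turing.TM2.stepAux q (v.1, v.2.1, a.head?, v.2.2.2) (P.contents x a.tail b c) := by
  exact congrArg (Turing.TM2.stepAux q _) (update_contents_cols ..)

theorem stepAux_popDone :
    Turing.TM2.stepAux (P.popDone q) v (P.contents x a b c) =
      Turing.TM2.stepAux q (v.1, v.2.1, b.head?, v.2.2.2) (P.contents x a b.tail c) := by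
  exact congrArg (Turing.TM2.stepAux q _) (update_contents_done ..)

theorem stepAux_popRow :
    Turing.TM2.stepAux (P.popRow q) v (P.contents x a b c) =
      Turing.TM2.stepAux q (v.1, v.2.1, c.head?, v.2.2.2) (P.contents x a b c.tail) := by
  exact congrArg (Turing.TM2.stepAux q _) (update_contents_rows ..)

theorem stepAux_pushInput (f : P.Memory → Bool) :
    Turing.TM2.stepAux (P.pushInput f q) v (P.contents x a b c) =
      Turing.TM2.stepAux q v (P.contents (f v :: x) a b c) := by
  exact congrArg (Turing.TM2.stepAux q _) (update_contents_input ..)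

theorem stepAux_pushCol (f : P.Memory → P.Q) :
    Turing.TM2.stepAux (P.pushCol f q) v (P.contents x a b c) =
      Turing.TM2.stepAux q v (P.contents x (f v :: a) b c) := by
  exact congrArg (Turing.TM2.stepAux q _) (update_contents_cols ..)

theorem stepAux_pushDone (f : P.Memory → P.Q) :
    Turing.TM2.stepAux (P.pushDone f q) v (P.contents x a b c) =
      Turing.TM2.stepAux q v (P.contents x a (f v :: b) c) := by
  exact congrArg (Turing.TM2.stepAux q _) (update_contents_done ..)

theorem stepAux_pushRow (f : P.Memory → P.Q) :
    Turing.TM2.stepAux (P.pushRow f q) v (P.contents x a b c) =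
      Turing.TM2.stepAux q v (P.contents x a b (f v :: c)) := by
  exact congrArg (Turing.TM2.stepAux q _) (update_contents_rows ..)

variable (P) in
/-- A configuration of the machine. -/
def cfg (l : Label) (v : P.Memory) (x : List Bool) (a b c : List P.Q) : P.Cfg :=
  ⟨some l, v, P.contents x a b c⟩

variable (P) in
/-- The machine gets from one configuration to another one in `n` steps. -/
def StepsTo (n : ℕ) (s t : P.Cfg) : Prop :=
  (flip bind (Turing.TM2.step P.prog))^[n] (some s) = some t

theorem StepsTo.trans {m n : ℕ} {s t u : P.Cfg} (h : P.StepsTo m s t) (h' : P.StepsTo n t u) :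
    P.StepsTo (m + n) s u := by
  unfold StepsTo at *
  rw [Nat.add_comm, Function.iterate_add_apply, h, h']

theorem StepsTo.cons {n : ℕ} {l : Label} {t u : P.Cfg}
    (h : Turing.TM2.stepAux (P.prog l) v (P.contents x a b c) = t)
    (h' : P.StepsTo n t u) : P.StepsTo (n + 1) (P.cfg l v x a b c) u := by
  unfold StepsTo at *
  rw [Function.iterate_succ_apply]
  rw [← h']
  congr 1
  rw [← h]
  rfl

theorem StepsTo.single {l : Label} {t : P.Cfg}
    (h : Turing.TM2.stepAux (P.prog l) v (P.contents x a b c) = t) :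
    P.StepsTo 1 (P.cfg l v x a b c) t :=
  StepsTo.cons x a b c v h rfl

theorem stepsTo_readPrefix (r : P.R) (k : Option P.Q) (f : Bool) (u : Buffer) :
    ∃ u', P.StepsTo ((P.splitPrefix x).1.length + 1) (P.cfg .readPrefix (r, u, k, f) x [] b [])
      (P.cfg .spread (r, u', k, f) (P.splitPrefix x).2 []
        ((P.splitPrefix x).1.reverse ++ b) []) := by
  fun_induction splitPrefix P x generalizing b u with
  | case1 x h ih =>
    obtain ⟨u', ih⟩ := ih (P.initCol (readBuffer x) :: b) (readBuffer x)
    refine ⟨u', StepsTo.cons _ _ _ _ _ (t := P.cfg .readPrefix _ _ _ _ _) ?_ (by simpa using ih)⟩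
    simp [prog, stepAux_popBuffer, stepAux_pushDone, cfg, h]
  | case2 x h =>
    refine ⟨readBuffer x, StepsTo.single _ _ _ _ _ ?_⟩
    have h' : (x[2]? == some true) = false := by simpa using h
    simp [prog, stepAux_popBuffer, stepAux_pushDone, cfg, h']

theorem stepsTo_spread (r : P.R) (k : Option P.Q) (f : Bool) (u : Buffer) :
    P.StepsTo (b.length + 1) (P.cfg .spread (r, u, k, f) x a b c)
      (P.cfg .newRow (r, u, none, f) x (b.reverse ++ a) [] (b.reverse ++ c)) := by
  induction b generalizing a c k with
  | nil =>
    refine StepsTo.single _ _ _ _ _ ?_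
    simp [prog, stepAux_popDone, cfg]
  | cons q b ih =>
    refine StepsTo.cons _ _ _ _ _ (t := P.cfg .spread _ _ _ _ _) ?_
      (by simpa using ih (q :: a) (q :: c) (some q))
    simp [prog, stepAux_popDone, stepAux_pushCol, stepAux_pushRow, cfg, present]

theorem stepsTo_cell (r : P.R) (k : Option P.Q) (f : Bool) (u : Buffer) :
    ∃ u', P.StepsTo (a.length + 1) (P.cfg .cell (r, u, k, f) x a b c)
      (P.cfg .restore ((scanRow P.entry r a x).1, u', none, f) (scanRow P.entry r a x).2.2 []
        ((scanRow P.entry r a x).2.1.reverse ++ b) c) := by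
  induction a generalizing x b k r u with
  | nil =>
    refine ⟨u, StepsTo.single _ _ _ _ _ ?_⟩
    simp [prog, stepAux_popCol, cfg, scanRow]
  | cons q a ih =>
    obtain ⟨u', ih⟩ := ih (x.drop 9) ((P.entry r q (readBuffer x)).2 :: b)
      (P.entry r q (readBuffer x)).1 (some q) (readBuffer x)
    refine ⟨u', StepsTo.cons _ _ _ _ _ (t := P.cfg .cell _ _ _ _ _) ?_
      (by simpa [scanRow] using ih)⟩
    simp [prog, stepAux_popCol, stepAux_popBuffer, stepAux_pushDone, cfg, present]

theorem stepsTo_restore (r : P.R) (k : Option P.Q) (u : Buffer) :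
    P.StepsTo (b.length + 1) (P.cfg .restore (r, u, k, false) x a b c)
      (P.cfg .newRow (r, u, none, false) x (b.reverse ++ a) [] c) := by
  induction b generalizing a k with
  | nil =>
    refine StepsTo.single _ _ _ _ _ ?_
    simp [prog, stepAux_popDone, cfg]
  | cons q b ih =>
    refine StepsTo.cons _ _ _ _ _ (t := P.cfg .restore _ _ _ _ _) ?_
      (by simpa using ih (q :: a) (some q))
    simp [prog, stepAux_popDone, stepAux_pushCol, cfg, present]

theorem stepsTo_restore_last (r : P.R) (k : Option P.Q) (u : Buffer) :
    P.StepsTo (b.length + 1) (P.cfg .restore (r, u, k, true) x a b c)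
      (P.cfg .clear (r, u, none, P.accept r x.isEmpty) x (b.reverse ++ a) [] c) := by
  induction b generalizing a k with
  | nil =>
    refine StepsTo.single _ _ _ _ _ ?_
    simp [prog, stepAux_popDone, cfg]
    cases x <;> rfl
  | cons q b ih =>
    refine StepsTo.cons _ _ _ _ _ (t := P.cfg .restore _ _ _ _ _) ?_
      (by simpa using ih (q :: a) (some q))
    simp [prog, stepAux_popDone, stepAux_pushCol, cfg, present]

@[simp] theorem length_scanRow (r : P.R) : (scanRow P.entry r a x).2.1.length = a.length := by
  induction a generalizing r x with
  | nil => rfl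
  | cons q a ih => simp [scanRow, ih]

theorem length_rest_scanRow_le (r : P.R) : (scanRow P.entry r a x).2.2.length ≤ x.length := by
  induction a generalizing r x with
  | nil => exact le_rfl
  | cons q a ih => exact (ih _ _).trans (by simp)

@[simp] theorem length_scanRows (r : P.R) :
    (scanRows P.entry P.row c r a x).2.1.length = a.length := by
  induction c generalizing r a x with
  | nil => rfl
  | cons q c ih => simp [scanRows, ih]

theorem length_rest_scanRows_le (r : P.R) :
    (scanRows P.entry P.row c r a x).2.2.length ≤ x.length := by
  induction c generalizing r a x with
  | nil => exact le_rfl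
  | cons q a ih => exact (ih _ _ _).trans (length_rest_scanRow_le _ _ _)

theorem stepsTo_row (r : P.R) (k : Option P.Q) (f : Bool) (u : Buffer) (q : P.Q) :
    ∃ u', P.StepsTo (2 * a.length + 3) (P.cfg .newRow (r, u, k, f) x a [] (q :: c))
      (P.cfg .newRow ((scanRow P.entry (P.row r (some q)) a x).1, u', none, false)
        (scanRow P.entry (P.row r (some q)) a x).2.2
        (scanRow P.entry (P.row r (some q)) a x).2.1 [] c) := by
  obtain ⟨u', h⟩ := stepsTo_cell x a [] c (P.row r (some q)) (some q) false u
  refine ⟨u', ?_⟩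
  have h₀ : P.StepsTo 1 (P.cfg .newRow (r, u, k, f) x a [] (q :: c))
      (P.cfg .cell (P.row r (some q), u, some q, false) x a [] c) := by
    refine StepsTo.single _ _ _ _ _ ?_
    simp [prog, stepAux_popRow, cfg]
  convert (h₀.trans h).trans (stepsTo_restore _ _ _ _ _ _ _) using 1
  · simp; ring
  · simp

theorem stepsTo_rows (r : P.R) (k : Option P.Q) (f : Bool) (u : Buffer) :
    ∃ u' k' f', P.StepsTo (c.length * (2 * a.length + 3)) (P.cfg .newRow (r, u, k, f) x a [] c)
      (P.cfg .newRow ((scanRows P.entry P.row c r a x).1, u', k', f')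
        (scanRows P.entry P.row c r a x).2.2
        (scanRows P.entry P.row c r a x).2.1 [] []) := by
  induction c generalizing r k f u x a with
  | nil => exact ⟨u, k, f, by simp [scanRows, StepsTo]⟩
  | cons q c ih =>
    obtain ⟨u₁, h₁⟩ := stepsTo_row x a c r k f u q
    obtain ⟨u', k', f', h⟩ := ih (scanRow P.entry (P.row r (some q)) a x).2.2
      (scanRow P.entry (P.row r (some q)) a x).2.1
        (scanRow P.entry (P.row r (some q)) a x).1 none false u₁
    refine ⟨u', k', f', ?_⟩
    convert h₁.trans h using 1
    · simp only [List.length_cons, length_scanRow]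
      ring
    · rfl

theorem stepsTo_lastRow (r : P.R) (k : Option P.Q) (f : Bool) (u : Buffer) :
    ∃ u', P.StepsTo (2 * a.length + 3) (P.cfg .newRow (r, u, k, f) x a [] [])
      (P.cfg .clear ((scanRow P.entry (P.row r none) a x).1, u', none,
          P.accept (scanRow P.entry (P.row r none) a x).1
            (scanRow P.entry (P.row r none) a x).2.2.isEmpty)
        (scanRow P.entry (P.row r none) a x).2.2
        (scanRow P.entry (P.row r none) a x).2.1 [] []) := by
  obtain ⟨u', h⟩ := stepsTo_cell x a [] [] (P.row r none) none true u
  refine ⟨u', ?_⟩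
  have h₀ : P.StepsTo 1 (P.cfg .newRow (r, u, k, f) x a [] [])
      (P.cfg .cell (P.row r none, u, none, true) x a [] []) := by
    refine StepsTo.single _ _ _ _ _ ?_
    simp [prog, stepAux_popRow, cfg]
  convert (h₀.trans h).trans (stepsTo_restore_last _ _ _ _ _ _ _) using 1
  · simp; ring
  · simp

theorem stepsTo_clear (r : P.R) (k : Option P.Q) (f : Bool) (u : Buffer) :
    P.StepsTo (max x.length a.length + 1) (P.cfg .clear (r, u, k, f) x a [] [])
      ⟨none, P.startState, P.contents [f] [] [] []⟩ := by
  induction h : max x.length a.length generalizing x a k u with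
  | zero =>
    obtain ⟨rfl, rfl⟩ : x = [] ∧ a = [] := by
      constructor <;> apply List.length_eq_zero_iff.1 <;> omega
    refine StepsTo.single _ _ _ _ _ ?_
    simp [prog, stepAux_popInput, stepAux_popCol, stepAux_pushInput]
  | succ n ih =>
    refine StepsTo.cons _ _ _ _ _ (t := P.cfg .clear _ _ _ _ _) ?_
      (ih x.tail a.tail a.head? (Function.update u 0 x.head?) (by simp; omega))
    have h' : (x.head?.isSome || a.head?.isSome) = true := by
      cases x <;> cases a <;> simp at h ⊢
    simp [prog, stepAux_popInput, stepAux_popCol, cfg, h']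

theorem length_splitPrefix_le :
    (P.splitPrefix x).1.length ≤ x.length ∧ (P.splitPrefix x).2.length ≤ x.length := by
  fun_induction splitPrefix P x with
  | case1 x h ih =>
    have : 2 < x.length := by
      by_contra h'
      simp_all
    simp only [List.length_drop, List.length_cons] at ih ⊢
    omega
  | case2 x h => simp

/-- With `m` columns the five phases take `m + 1`, `m + 1`, `m * (2 * m + 3)`, `2 * m + 3` and at
most `x.length + 1` steps, and `m ≤ x.length`. -/
theorem exists_stepsTo_halt : ∃ n ≤ 2 * x.length ^ 2 + 8 * x.length + 6,
    P.StepsTo n (P.cfg .readPrefix P.startState x [] [] [])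
      ⟨none, P.startState, P.contents [P.result x] [] [] []⟩ := by
  obtain ⟨u₁, h₁⟩ := stepsTo_readPrefix x [] P.initState none false fun _ => none
  have h₂ := stepsTo_spread (P.splitPrefix x).2 [] ((P.splitPrefix x).1.reverse ++ []) []
    P.initState none false u₁
  simp only [List.append_nil, List.reverse_reverse, List.length_reverse] at h₁ h₂
  obtain ⟨u₃, k₃, f₃, h₃⟩ := stepsTo_rows (P.splitPrefix x).2 (P.splitPrefix x).1
    (P.splitPrefix x).1 P.initState none false u₁
  set t := scanRows P.entry P.row (P.splitPrefix x).1 P.initState (P.splitPrefix x).1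
    (P.splitPrefix x).2
    with ht
  obtain ⟨u₄, h₄⟩ := stepsTo_lastRow t.2.2 t.2.1 t.1 k₃ f₃ u₃
  have h₅ := stepsTo_clear (scanRow P.entry (P.row t.1 none) t.2.1 t.2.2).2.2
    (scanRow P.entry (P.row t.1 none) t.2.1 t.2.2).2.1
    (scanRow P.entry (P.row t.1 none) t.2.1 t.2.2).1 none
    (P.accept (scanRow P.entry (P.row t.1 none) t.2.1 t.2.2).1
      (scanRow P.entry (P.row t.1 none) t.2.1 t.2.2).2.2.isEmpty) u₄
  refine ⟨_, ?_, (((h₁.trans h₂).trans h₃).trans h₄).trans h₅⟩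
  obtain ⟨hp, hr⟩ := length_splitPrefix_le (P := P) x
  have hl : (scanRow P.entry (P.row t.1 none) t.2.1 t.2.2).2.2.length ≤ x.length :=
    ((length_rest_scanRow_le _ _ _).trans (length_rest_scanRows_le _ _ _ _)).trans hr
  have hm : max (scanRow P.entry (P.row t.1 none) t.2.1 t.2.2).2.2.length
      (scanRow P.entry (P.row t.1 none) t.2.1 t.2.2).2.1.length ≤ x.length := by
    refine max_le hl ?_
    simpa [ht] using hp
  have ht' : t.2.1.length = (P.splitPrefix x).1.length := by simp [ht]
  rw [ht']
  nlinarith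

variable (P) in
/-- The Turing machine. -/
def machine : Turing.FinTM2 where
  K := Stack
  k₀ := .input
  k₁ := .input
  Γ := P.Alphabet
  Λ := Label
  main := .readPrefix
  σ := P.Memory
  initialState := P.startState
  Γk₀Fin := inferInstanceAs (Fintype Bool)
  m := P.prog

theorem initList_machine : Turing.initList P.machine x =
    P.cfg .readPrefix P.startState x [] [] [] := by
  unfold Turing.initList cfg
  congr 1
  funext k
  cases k <;> rfl

theorem haltList_machine :
    Turing.haltList P.machine x = (⟨none, P.startState, P.contents x [] [] []⟩ : P.Cfg) := by
  unfold Turing.haltList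
  congr 1
  funext k
  cases k <;> rfl

/-- A language that is decided by a scanner is decidable in polynomial time. -/
theorem result_mem_PTIME (P : Scanner) : {x | P.result x = true} ∈ PTIME := by
  refine ⟨P.result, fun w => Iff.rfl, ⟨?_⟩⟩
  refine
    { tm := P.machine
      inputAlphabet := Equiv.refl Bool
      outputAlphabet := Equiv.refl Bool
      time := 2 * Polynomial.X ^ 2 + 8 * Polynomial.X + 6
      outputsFun := fun x => ?_ }
  refine
    { steps := (exists_stepsTo_halt (P := P) x).choose
      evals_in_steps := ?_
      steps_le_m := ?_ }
  · have h := (exists_stepsTo_halt (P := P) x).choose_spec.2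
    have hx : x.map (Equiv.refl Bool).invFun = x := List.map_id x
    have hi := initList_machine (P := P) x
    have ho := haltList_machine (P := P) [P.result x]
    refine Eq.trans ?_ (Eq.trans h (congrArg some ho.symm))
    exact congrArg (fun s : P.Cfg => (flip bind (Turing.TM2.step P.prog))^[_] (some s))
      ((congrArg (Turing.initList P.machine) hx).trans hi)
  · have h := (exists_stepsTo_halt (P := P) x).choose_spec.1
    simpa using h

end Scanner

end Complexity

/-! ### Two rounds of guessing -/

namespace Complexity

/-- A letter of the input, two bits from the first round of guessing, and six bits from the second
round. -/
abbrev Block : Type := (Bool × Bool × Bool) × (Fin 6 → Bool)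

/-- Each round reverses the word, so the order of the letters is restored after two rounds, but the
second-round bits now precede the letters they annotate. Positions 2, 5, 8 hold the input letter and
its two first-round bits. -/
def encodeBlock (b : Block) : List Bool :=
  [b.2 0, b.2 1, b.1.1, b.2 2, b.2 3, b.1.2.1, b.2 4, b.2 5, b.1.2.2]

def encodeBlocks (u : List Block) : List Bool := u.flatMap encodeBlock

@[simp] theorem encodeBlocks_nil : encodeBlocks [] = [] := rfl

@[simp] theorem encodeBlocks_cons (b : Block) (u : List Block) :
    encodeBlocks (b :: u) = encodeBlock b ++ encodeBlocks u := rfl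

theorem drop_encodeBlocks (u : List Block) (k : ℕ) :
    (encodeBlocks u).drop (9 * k) = encodeBlocks (u.drop k) := by
  induction k generalizing u with
  | zero => simp
  | succ k ih =>
    cases u with
    | nil => simp
    | cons b u =>
      rw [List.drop_succ_cons, ← ih, Nat.mul_add, Nat.add_comm, ← List.drop_drop]
      rfl

@[simp] theorem isEmpty_encodeBlocks (u : List Block) : (encodeBlocks u).isEmpty = u.isEmpty := by
  cases u <;> rfl

/-- The letters of a block that may be missing. -/
def blockBuffer : Option Block → Buffer
  | none => fun _ => none
  | some b => fun i => (encodeBlock b)[(i : ℕ)]?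

theorem readBuffer_encodeBlocks (u : List Block) :
    readBuffer (encodeBlocks u) = blockBuffer u[0]? := by
  cases u with
  | nil => funext i; simp [readBuffer, blockBuffer]
  | cons b u =>
    funext i
    simp [readBuffer, blockBuffer, List.getElem?_append_left (l₁ := encodeBlock b) i.isLt]

theorem readBuffer_drop_encodeBlocks (u : List Block) (k : ℕ) :
    readBuffer ((encodeBlocks u).drop (9 * k)) = blockBuffer u[k]? := by
  rw [drop_encodeBlocks, readBuffer_encodeBlocks]
  simp

/-- The two reversals cancel, and the second-round annotations of the three letters of one triple
are gathered into a block. -/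
theorem exists_triples_iff_exists_blocks (O : Lang) (l : List (Bool × Bool × Bool)) :
    (∃ m : List (Bool × Bool × Bool), m.map Prod.fst = (flattenTriples l).reverse ∧
      (flattenTriples m).reverse ∈ O) ↔
    ∃ u : List Block, u.map Prod.fst = l ∧ encodeBlocks u ∈ O := by
  constructor
  · rintro ⟨m, hm, hO⟩
    suffices h : ∀ m : List (Bool × Bool × Bool), m.map Prod.fst = flattenTriples l →
        ∃ u : List Block, u.map Prod.fst = l ∧
          encodeBlocks u = m.flatMap fun t => [t.2.2, t.2.1, t.1] by
      obtain ⟨u, hu, hu'⟩ := h m.reverse (by simp [hm])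
      refine ⟨u, hu, ?_⟩
      rw [hu']
      convert hO using 1
      simp [flattenTriples, List.reverse_flatMap, Function.comp_def]
    clear hm hO m
    induction l with
    | nil =>
      intro m hm
      obtain rfl : m = [] := by simpa using hm
      exact ⟨[], rfl, rfl⟩
    | cons t l ih =>
      intro m hm
      obtain _ | ⟨a, _ | ⟨b, _ | ⟨c, m⟩⟩⟩ := m <;> simp at hm
      obtain ⟨ha, hb, hc, hm⟩ := hm
      obtain ⟨u, hu, hu'⟩ := ih m (by simpa using hm)
      refine ⟨((t.1, t.2.1, t.2.2), ![a.2.2, a.2.1, b.2.2, b.2.1, c.2.2, c.2.1]) :: u, by simp [hu],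
        ?_⟩
      simp [hu', encodeBlock, ← ha, ← hb, ← hc]
  · rintro ⟨u, rfl, hO⟩
    refine ⟨(u.flatMap fun b => [(b.1.1, b.2 1, b.2 0), (b.1.2.1, b.2 3, b.2 2),
      (b.1.2.2, b.2 5, b.2 4)]).reverse, ?_, ?_⟩
    · rw [List.map_reverse]
      congr 1
      simp [flattenTriples, List.map_flatMap, List.flatMap_map]
    · convert hO using 1
      clear hO
      induction u with
      | nil => rfl
      | cons b u ih =>
        simp only [List.flatMap_cons, List.reverse_append, flattenTriples_append, ih,
          encodeBlocks_cons]
        rfl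

/-- The inner machine accepts on a positive answer and the outer one on a negative answer, which
turns the inner existential quantifier into a universal one. -/
theorem mem_SigmaP_two (P : Scanner) :
    {w | ∃ l : List (Bool × Bool × Bool), l.map Prod.fst = w ∧
      ∀ u : List Block, u.map Prod.fst = l → P.result (encodeBlocks u) = false} ∈ SigmaP 2 := by
  refine ⟨_, ⟨_, P.result_mem_PTIME, guess_mem_NPWithOracle _ true⟩, ?_⟩
  convert guess_mem_NPWithOracle _ false using 1
  ext w
  simp only [Set.mem_ofPred_eq, iff_true, Bool.false_eq_true, iff_false]
  refine exists_congr fun l => and_congr_right fun _ => ?_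
  have := exists_triples_iff_exists_blocks {x | P.result x = true} l
  simp only [Set.mem_ofPred_eq] at this
  rw [this]
  simp

theorem Scanner.splitPrefix_encodeBlocks (P : Scanner) (u : List Block) :
    P.splitPrefix (encodeBlocks u) =
      ((u.takeWhile fun b => b.1.1).map fun b => P.initCol (blockBuffer (some b)),
        encodeBlocks (u.dropWhile fun b => b.1.1).tail) := by
  induction u with
  | nil => rw [splitPrefix]; simp
  | cons b u ih =>
    rw [splitPrefix, readBuffer_encodeBlocks]
    have h2 : (encodeBlocks (b :: u))[2]? = some b.1.1 := rfl
    have hd : (encodeBlocks (b :: u)).drop 9 = encodeBlocks u := rfl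
    rw [h2, hd, ih]
    cases h : b.1.1 <;> simp [h]

end Complexity

/-! ### The scanner that searches for errors in a guessed certificate -/

namespace Argumentation

open Complexity

/-- The bit at a position of a block. -/
def bitAt (i : Fin 9) (b : Buffer) : Bool := (b i).getD false

namespace Semantics

/-- Whether arguments in extensions have to be defended. -/
def defends : Semantics → Bool
  | preferred => true
  | semiStable => true
  | stage => false

/-- Whether an argument counts for the comparison of sets of arguments, depending on whether it
belongs to the set and whether it is attacked by the set. -/
def counts : Semantics → Bool → Bool → Bool
  | preferred, e, _ => e
  | semiStable, e, d => e || d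
  | stage, e, d => e || d

end Semantics

namespace Check

/-- What the scanner can observe. -/
inductive Event
  | nonempty
  | malformed
  | inconsistent
  | marked
  | wrong
  | notRefuting
  | strict
  deriving DecidableEq

instance : Fintype Event :=
  ⟨{.nonempty, .malformed, .inconsistent, .marked, .wrong, .notRefuting, .strict}, by
    rintro ⟨⟩ <;> simp⟩

/-- The state of a column: its block in the prefix, whether the argument is attacked by the first
or the second set, and a bit of the counter. -/
abbrev Col : Type := Buffer × (Bool → Bool) × Bool

/-- The block of the row in the prefix, the events so far, the carry bit of the counter, whether one
selected argument is to be skipped, and the last bit in the last row. -/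
structure State where
  label : Option Buffer
  events : Event → Bool
  carry : Bool
  skip : Bool
  last : Bool

instance : Finite State :=
  Finite.of_injective (fun s : State => (s.label, s.events, s.carry, s.skip, s.last)) <| by
    rintro ⟨⟩ ⟨⟩ h
    simp only [Prod.mk.injEq] at h
    simpa using h

noncomputable instance : Fintype State := Fintype.ofFinite _

/-- Membership in the first set (`false`) or the second set (`true`). -/
def inSet (s : Bool) (b : Buffer) : Bool := bitAt (cond s 6 3) b

/-- Whether the argument is claimed to be attacked by the first or the second set. -/
def attacked (s : Bool) (b : Buffer) : Bool := bitAt (cond s 7 4) b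

/-- Whether the argument is selected. -/
def selected (b : Buffer) : Bool := bitAt 5 b

/-- Whether one of the two witnesses for the argument is examined. -/
def mark (s : Bool) (b : Buffer) : Bool := bitAt (cond s 1 0) b

/-- A bit of one of the two witnesses. -/
def witness (s : Bool) (b : Buffer) : Bool := bitAt (cond s 8 5) b

/-- The events at an entry of the matrix with the blocks for its row and its column. -/
def entryEvent (sem : Semantics) (row col b : Buffer) : Event → Bool
  | .nonempty => true
  | .malformed => (b 2).isNone
  -- Several rows may be marked: every marked witness has to equal the first set, so uniqueness of
  -- the mark need not be tested.
  | .inconsistent => (mark false row || mark true row) && !selected row ||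
      mark false row && (witness false b != inSet false col) ||
      mark true row && (witness true b != inSet false col)
  | .marked => mark false row || mark true row
  | .wrong => mark false row && !inSet false row || mark true row && inSet false row ||
      bitAt 2 b && inSet false row && inSet false col ||
      sem.defends && bitAt 2 b && inSet false col && !attacked false row
  | .notRefuting => bitAt 2 b && inSet true row && inSet true col ||
      sem.defends && bitAt 2 b && inSet true col && !attacked true row ||
      sem.counts (inSet false row) (attacked false row) &&
        !sem.counts (inSet true row) (attacked true row)
  | .strict => !sem.counts (inSet false row) (attacked false row) &&
      sem.counts (inSet true row) (attacked true row)

/-- The events in the additional row. -/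
def lastEvent (q : Col) (b : Buffer) : Event → Bool
  | .malformed => bitAt 2 b != q.2.2
  | .inconsistent => (q.2.1 false != attacked false q.1) || (q.2.1 true != attacked true q.1)
  | _ => false

/-- The third components of the column states form a binary counter, lowest digit first, through
which a carry runs along each row. The second components accumulate which arguments are attacked;
they are complete only after the last row, which is why the attacked sets are guessed and compared
there. -/
def entry (sem : Semantics) (r : State) (q : Col) (b : Buffer) : State × Col :=
  match r.label with
  | some row =>
    ({ r with
        events := fun e => r.events e || entryEvent sem row q.1 b e
        carry := r.carry && q.2.2 },
      (q.1, fun s => q.2.1 s || bitAt 2 b && inSet s row, r.carry ^^ q.2.2))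
  | none =>
    ({ r with
        events := fun e => r.events e || lastEvent q b e
        last := (b 2).getD r.last },
      q)

/-- A selected row starts with carry one and so increments the counter, except that a pending `skip`
absorbs the first selected row. -/
def newRow (r : State) (q : Option Col) : State :=
  match q with
  | some q => { r with
      label := some q.1
      carry := selected q.1 && !r.skip
      skip := r.skip && !selected q.1 }
  | none => { r with label := none }

/-- The state shows that the word is the encoding of a framework `F` and a number `k`, and that the
number of selected arguments is as required. -/
def wellFormed (r : State) (atEnd : Bool) : Bool :=
  r.events .nonempty && !r.events .malformed && atEnd && r.last && !r.skip

/-- The state shows that one of the witnesses is wrong. -/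
def refuted (r : State) : Bool :=
  !r.events .inconsistent && r.events .marked &&
    (r.events .wrong || !r.events .notRefuting && r.events .strict)

/-- The scanner that looks for errors; `d` says that the number of selected arguments has to be
`k + 1` instead of `k`. -/
noncomputable def scanner (sem : Semantics) (d : Bool) : Scanner where
  Q := Col
  R := State
  initCol b := (b, fun _ => false, false)
  -- `skip` starts as `d`, so that the counter ends `d` below the number of selected arguments.
  -- `last` starts as `true` because zero has no binary digits.
  initState := ⟨none, fun _ => false, false, d, true⟩
  row := newRow
  entry := entry sem
  accept r atEnd := !wellFormed r atEnd || refuted r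

/-- The number with the given binary digits, least significant first. -/
def bitsValue : List Bool → ℕ
  | [] => 0
  | b :: l => Nat.bit b (bitsValue l)

/-! ### Invariants of the scan. -/

variable (sem : Semantics)

/-- The last clause is ripple-carry addition: the row adds its incoming carry to the counter, and
the outgoing carry counts for `2 ^ qs.length`. -/
theorem scanRow_of_label_eq_some (r : State) (row : Buffer) (hr : r.label = some row)
    (qs : List Col) (x : List Bool) :
    ((scanRow (entry sem) r qs x).2.2 = x.drop (9 * qs.length)) ∧
    ((scanRow (entry sem) r qs x).1.skip = r.skip) ∧
    ((scanRow (entry sem) r qs x).1.last = r.last) ∧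
    (∀ e, (scanRow (entry sem) r qs x).1.events e = true ↔ r.events e = true ∨
      ∃ j q, qs[j]? = some q ∧
        entryEvent sem row q.1 (readBuffer (x.drop (9 * j))) e = true) ∧
    (∀ j q, qs[j]? = some q → ∃ t, (scanRow (entry sem) r qs x).2.1[j]? = some
      (q.1, fun s => q.2.1 s || bitAt 2 (readBuffer (x.drop (9 * j))) && inSet s row, t)) ∧
    bitsValue ((scanRow (entry sem) r qs x).2.1.map fun q => q.2.2) +
        2 ^ qs.length * (scanRow (entry sem) r qs x).1.carry.toNat =
      bitsValue (qs.map fun q => q.2.2) + r.carry.toNat := by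
  induction qs generalizing r x with
  | nil => simp [scanRow, bitsValue]
  | cons q qs ih =>
    have he : entry sem r q (readBuffer x) =
      ({ r with
        events := fun e => r.events e || entryEvent sem row q.1 (readBuffer x) e
        carry := r.carry && q.2.2 },
      (q.1, fun s => q.2.1 s || bitAt 2 (readBuffer x) && inSet s row, r.carry ^^ q.2.2)) := by
      simp [entry, hr]
    obtain ⟨h₁, h₂, h₃, h₄, h₅, h₆⟩ := ih (entry sem r q (readBuffer x)).1
      (by rw [he]; exact hr) (x.drop 9)
    simp only [scanRow]
    refine ⟨?_, ?_, ?_, fun e => ?_, fun j p hj => ?_, ?_⟩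
    · rw [h₁, List.drop_drop, List.length_cons]
      congr 1; ring
    · rw [h₂, he]
    · rw [h₃, he]
    · rw [h₄, he]
      simp only [Bool.or_eq_true, or_assoc, List.drop_drop]
      refine or_congr_right ?_
      constructor
      · rintro (h | ⟨j, p, hj, h⟩)
        · exact ⟨0, q, rfl, by simpa using h⟩
        · exact ⟨j + 1, p, by simpa using hj, by rwa [show 9 * (j + 1) = 9 + 9 * j by ring]⟩
      · rintro ⟨_ | j, p, hj, h⟩
        · obtain rfl : q = p := by simpa using hj
          exact Or.inl (by simpa using h)
        · refine Or.inr ⟨j, p, by simpa using hj, ?_⟩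
          rwa [show 9 * (j + 1) = 9 + 9 * j by ring] at h
    · obtain _ | j := j
      · obtain rfl : q = p := by simpa using hj
        exact ⟨r.carry ^^ q.2.2, by simp [he]⟩
      · obtain ⟨t, ht⟩ := h₅ j p (by simpa using hj)
        refine ⟨t, ?_⟩
        rw [List.drop_drop] at ht
        rw [show 9 * (j + 1) = 9 + 9 * j by ring]
        simpa using ht
    · rw [he] at h₆ ⊢
      simp only [List.map_cons, bitsValue, List.length_cons, Nat.bit_val, pow_succ] at h₆ ⊢
      generalize scanRow (entry sem) _ qs _ = w at h₆ ⊢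
      generalize bitsValue _ = A at h₆ ⊢
      generalize bitsValue _ = A' at h₆ ⊢
      -- The half adder at one digit.
      have : (r.carry ^^ q.2.2).toNat + 2 * (r.carry && q.2.2).toNat =
          r.carry.toNat + q.2.2.toNat := by
        cases r.carry <;> cases q.2.2 <;> rfl
      linarith

theorem length_scanRow_entry (r : State) (qs : List Col) (x : List Bool) :
    (scanRow (entry sem) r qs x).2.1.length = qs.length := by
  induction qs generalizing r x with
  | nil => rfl
  | cons q qs ih => simp [scanRow, ih]

/-- A row adds at most one to the counter, so `h` excludes overflow. In the last clause a selected
row either increments the counter or uses up `skip`. -/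
theorem scanRows_eq (r : State) (cs qs : List Col) (x : List Bool)
    (h : bitsValue (qs.map fun q => q.2.2) + cs.length < 2 ^ qs.length) :
    (scanRows (entry sem) newRow cs r qs x).2.1.length = qs.length ∧
    (scanRows (entry sem) newRow cs r qs x).2.2 = x.drop (9 * (qs.length * cs.length)) ∧
    (scanRows (entry sem) newRow cs r qs x).1.last = r.last ∧
    (∀ e, (scanRows (entry sem) newRow cs r qs x).1.events e = true ↔ r.events e = true ∨
      ∃ i c j q, cs[i]? = some c ∧ qs[j]? = some q ∧
        entryEvent sem c.1 q.1 (readBuffer (x.drop (9 * (qs.length * i + j)))) e = true) ∧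
    (∀ j q, qs[j]? = some q → ∃ f t,
      (scanRows (entry sem) newRow cs r qs x).2.1[j]? = some (q.1, f, t) ∧
      ∀ s, f s = true ↔ q.2.1 s = true ∨ ∃ i c, cs[i]? = some c ∧
        bitAt 2 (readBuffer (x.drop (9 * (qs.length * i + j)))) = true ∧ inSet s c.1 = true) ∧
    ((scanRows (entry sem) newRow cs r qs x).1.skip = true ↔
      r.skip = true ∧ cs.countP (fun c => selected c.1) = 0) ∧
    bitsValue ((scanRows (entry sem) newRow cs r qs x).2.1.map fun q => q.2.2) + r.skip.toNat =
      bitsValue (qs.map fun q => q.2.2) + cs.countP (fun c => selected c.1) +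
        (scanRows (entry sem) newRow cs r qs x).1.skip.toNat := by
  induction cs generalizing r qs x with
  | nil =>
    simp only [scanRows, List.length_nil, mul_zero, List.drop_zero, List.getElem?_nil,
      reduceCtorEq, false_and, exists_false, or_false, List.countP_nil, add_zero,
      implies_true, true_and, and_true]
    exact fun j q hj => ⟨q.2.1, q.2.2, hj, fun _ => Iff.rfl⟩
  | cons c cs ih =>
    have hlab : (newRow r (some c)).label = some c.1 := rfl
    obtain ⟨h₁, h₂, h₃, h₄, h₅, h₆⟩ := scanRow_of_label_eq_some sem _ _ hlab qs x
    have hlen := length_scanRow_entry sem (newRow r (some c)) qs x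
    have hskip : (newRow r (some c)).carry.toNat + r.skip.toNat =
        (selected c.1).toNat + (newRow r (some c)).skip.toNat := by
      simp only [newRow]
      cases selected c.1 <;> cases r.skip <;> rfl
    have hskip' : (newRow r (some c)).skip = (r.skip && !selected c.1) := rfl
    have hlast : (newRow r (some c)).last = r.last := rfl
    have hev : (newRow r (some c)).events = r.events := rfl
    have hcarry := (newRow r (some c)).carry.toNat_le
    simp only [scanRows]
    generalize newRow r (some c) = r₁ at *
    -- An outgoing carry would put at least `2 ^ qs.length` on the left of `h₆`, against `h`.
    have hc : (scanRow (entry sem) r₁ qs x).1.carry.toNat = 0 := by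
      by_contra hne
      have := Nat.le_mul_of_pos_right (2 ^ qs.length) (Nat.pos_of_ne_zero hne)
      simp only [List.length_cons] at h
      omega
    rw [hc] at h₆
    generalize scanRow (entry sem) r₁ qs x = t at *
    obtain ⟨i₁, i₂, i₃, i₄, i₅, i₇, i₆⟩ := ih t.1 t.2.1 t.2.2 (by
      rw [hlen]; simp only [List.length_cons] at h; omega)
    have hidx (i j : ℕ) : 9 * qs.length + 9 * (qs.length * i + j) =
        9 * (qs.length * (i + 1) + j) := by ring
    rw [hlen] at i₁ i₂
    simp only [h₁, hlen, List.drop_drop, hidx] at i₄ i₅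
    refine ⟨i₁, ?_, ?_, fun e => ?_, fun j q hj => ?_, ?_, ?_⟩
    · rw [i₂, h₁, List.drop_drop, List.length_cons]
      congr 1; ring
    · rw [i₃, h₃, hlast]
    · rw [h₁, i₄, h₄, hev, or_assoc]
      refine or_congr_right ?_
      constructor
      · rintro (⟨j, q, hj, hq⟩ | ⟨i, c', j, q, hi, hj, hq⟩)
        · exact ⟨0, c, j, q, rfl, hj, by simpa using hq⟩
        · obtain ⟨q', hq'⟩ : ∃ q', qs[j]? = some q' := by
            have : j < qs.length := by
              rw [← hlen]; exact (List.getElem?_eq_some_iff.1 hj).1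
            exact ⟨_, List.getElem?_eq_getElem this⟩
          obtain ⟨s, hs⟩ := h₅ j q' hq'
          obtain rfl := Option.some.inj (hs.symm.trans hj)
          exact ⟨i + 1, c', j, q', by simpa using hi, hq', hq⟩
      · rintro ⟨_ | i, c', j, q, hi, hj, hq⟩
        · obtain rfl : c = c' := by simpa using hi
          exact Or.inl ⟨j, q, hj, by simpa using hq⟩
        · obtain ⟨s, hs⟩ := h₅ j q hj
          exact Or.inr ⟨i, c', j, _, by simpa using hi, hs, hq⟩
    · obtain ⟨s, hs⟩ := h₅ j q hj
      obtain ⟨f, k, hf, hf'⟩ := i₅ j _ hs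
      refine ⟨f, k, by rw [h₁]; exact hf, fun s => ?_⟩
      rw [hf']
      simp only [Bool.or_eq_true, Bool.and_eq_true, or_assoc]
      refine or_congr_right ?_
      constructor
      · rintro (hq | ⟨i, c', hi, hq⟩)
        · exact ⟨0, c, rfl, by simpa using hq⟩
        · exact ⟨i + 1, c', by simpa using hi, hq⟩
      · rintro ⟨_ | i, c', hi, hq⟩
        · obtain rfl : c = c' := by simpa using hi
          exact Or.inl (by simpa using hq)
        · exact Or.inr ⟨i, c', by simpa using hi, hq⟩
    · rw [i₇, h₂, hskip', List.countP_cons]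
      cases selected c.1 <;> simp
    · rw [h₂] at i₆
      rw [List.countP_cons]
      have : (if selected c.1 = true then 1 else 0) = (selected c.1).toNat := by
        cases selected c.1 <;> rfl
      rw [this]
      omega

theorem scanRow_of_label_eq_none (r : State) (hr : r.label = none) (qs : List Col)
    (v : List Block) :
    (scanRow (entry sem) r qs (encodeBlocks v)).2.2 = encodeBlocks (v.drop qs.length) ∧
    (scanRow (entry sem) r qs (encodeBlocks v)).1.skip = r.skip ∧
    (v.length ≤ qs.length → (scanRow (entry sem) r qs (encodeBlocks v)).1.last =
      ((v.map fun b => b.1.1).getLast?).getD r.last) ∧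
    (∀ e, (scanRow (entry sem) r qs (encodeBlocks v)).1.events e = true ↔ r.events e = true ∨
      ∃ (j : ℕ) (q : Col), qs[j]? = some q ∧ lastEvent q (blockBuffer v[j]?) e = true) := by
  induction qs generalizing r v with
  | nil => simp +contextual [scanRow]
  | cons q qs ih =>
    have he : entry sem r q (readBuffer (encodeBlocks v)) = ({ r with
        events := fun e => r.events e || lastEvent q (blockBuffer v[0]?) e
        last := (blockBuffer v[0]? 2).getD r.last }, q) := by
      rw [readBuffer_encodeBlocks]
      simp [entry, hr]
    have hd : (encodeBlocks v).drop 9 = encodeBlocks (v.drop 1) := drop_encodeBlocks v 1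
    obtain ⟨h₁, h₂, h₃, h₄⟩ := ih (entry sem r q (readBuffer (encodeBlocks v))).1
      (by rw [he]; exact hr) (v.drop 1)
    simp only [scanRow, hd]
    refine ⟨?_, ?_, fun h => ?_, fun e => ?_⟩
    · rw [h₁, List.drop_drop, List.length_cons, Nat.add_comm]
    · rw [h₂, he]
    · rw [h₃ (by simp only [List.length_drop, List.length_cons] at h ⊢; omega), he]
      obtain _ | ⟨b, v⟩ := v
      · simp [blockBuffer]
      · simp [blockBuffer, encodeBlock, List.getLast?_cons]
    · rw [h₄, he]
      simp only [Bool.or_eq_true, or_assoc, List.getElem?_drop]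
      refine or_congr_right ?_
      constructor
      · rintro (h | ⟨j, p, hj, h⟩)
        · exact ⟨0, q, rfl, h⟩
        · exact ⟨j + 1, p, by simpa using hj, by rwa [Nat.add_comm]⟩
      · rintro ⟨_ | j, p, hj, h⟩
        · obtain rfl : q = p := by simpa using hj
          exact Or.inl h
        · exact Or.inr ⟨j, p, by simpa using hj, by rwa [Nat.add_comm]⟩

end Check

end Argumentation

namespace Argumentation

/-! ### Refuting witnesses for facets -/

section

variable {A : Type*} (sem : Semantics) (F : AF A)

/-- The arguments attacked by `E`. -/
def attackedBy (E : Set A) : Set A := {a | ∃ b ∈ E, F.Adj b a}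

/-- The sets among which the extensions are maximal. -/
def Semantics.Base (E : Set A) : Prop :=
  ConflictFree F E ∧ (sem.defends = true → ∀ a ∈ E, ∀ b, F.Adj b a → b ∈ attackedBy F E)

open Classical in
/-- The set that is maximized, in terms of a set of arguments and the arguments it attacks. -/
def Semantics.measure (E D : Set A) : Set A :=
  {a | sem.counts (decide (a ∈ E)) (decide (a ∈ D)) = true}

/-- The measure is the set itself for preferred extensions and the range for the other two
semantics; defence is dropped for stage extensions. -/
theorem mem_extensions_iff (E : Set A) :
    E ∈ sem.extensions F ↔ sem.Base F E ∧ ¬ ∃ E', sem.Base F E' ∧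
      sem.measure E (attackedBy F E) ⊂ sem.measure E' (attackedBy F E') := by
  have h₁ (E : Set A) : Semantics.measure .preferred E (attackedBy F E) = E := by
    simp [Semantics.measure, Semantics.counts]
  have h₂ (E : Set A) : Semantics.measure .semiStable E (attackedBy F E) = rangeOf F E := by
    ext a
    simp [Semantics.measure, Semantics.counts, rangeOf]
    rfl
  have h₃ (E : Set A) : Semantics.measure .stage E (attackedBy F E) = rangeOf F E := by
    ext a
    simp [Semantics.measure, Semantics.counts, rangeOf]
    rfl
  cases sem
  · simp only [h₁, Semantics.Base, Semantics.defends]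
    simp [Semantics.extensions, Preferred, Admissible, Defended, attackedBy]
  · simp only [h₂, Semantics.Base, Semantics.defends]
    simp [Semantics.extensions, SemiStable, Admissible, Defended, attackedBy]
  · simp only [h₃, Semantics.Base, Semantics.defends]
    simp [Semantics.extensions, Stage]

/-- Let `X false i` and `X true i` be proposed extensions with and without the argument `i`, for
the arguments `i` of `S`. The sets `P s` of arguments, `E false`, which is to be one of the proposed
extensions, `E true`, and the sets `D s` of arguments attacked by them show that the proposal is
wrong. -/
def Refutes (S : Set A) (X : Bool → A → Set A) (P E D : Bool → Set A) : Prop :=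
  (∀ s, P s ⊆ S) ∧ (∀ s, ∀ i ∈ P s, X s i = E false) ∧ (∀ s, D s = attackedBy F (E s)) ∧
  (∃ s, (P s).Nonempty) ∧
  ((∃ i ∈ P false, i ∉ E false) ∨ (∃ i ∈ P true, i ∈ E false) ∨ ¬ ConflictFree F (E false) ∨
    ¬ (sem.defends = true → ∀ a ∈ E false, ∀ b, F.Adj b a → b ∈ D false) ∨
    (ConflictFree F (E true) ∧
      (sem.defends = true → ∀ a ∈ E true, ∀ b, F.Adj b a → b ∈ D true) ∧
      sem.measure (E false) (D false) ⊂ sem.measure (E true) (D true)))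

/-- If `X s i` is wrong, marking only `i` on side `s` and taking `E false = X s i` yields a
refutation. Conversely, a nonempty set of marks forces `E false` to be a proposed extension, and
correct proposals have none of the listed defects. -/
theorem forall_not_refutes_iff (S : Set A) (X : Bool → A → Set A) :
    (∀ P E D, ¬ Refutes sem F S X P E D) ↔
      ∀ i ∈ S, (X false i ∈ sem.extensions F ∧ i ∈ X false i) ∧
        (X true i ∈ sem.extensions F ∧ i ∉ X true i) := by
  constructor
  · intro h i hi
    have key (s : Bool) : X s i ∈ sem.extensions F := by
      rw [mem_extensions_iff]
      have h' (E' : Set A) := h (fun t => if t = s then {i} else ∅) (fun t => cond t E' (X s i))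
        fun t => attackedBy F (cond t E' (X s i))
      simp only [Refutes] at h'
      have h₁ : ∀ t, (if t = s then ({i} : Set A) else ∅) ⊆ S := by
        intro t; split_ifs <;> simp [hi]
      have h₂ : ∀ t, ∀ j ∈ (if t = s then ({i} : Set A) else ∅), X t j = X s i := by
        intro t j hj
        split_ifs at hj with ht
        · rw [ht, Set.mem_singleton_iff.1 hj]
        · exact hj.elim
      have h₃ : ∃ t, (if t = s then ({i} : Set A) else ∅).Nonempty := ⟨s, by simp⟩
      by_contra hE
      rw [Semantics.Base] at hE
      simp only [cond_false, cond_true, implies_true, true_and, h₁, h₃] at h'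
      have h'' := fun E' hb => h' E' ⟨h₂, hb⟩
      simp only [not_and, not_not, Semantics.Base] at hE
      by_cases hc : ConflictFree F (X s i)
      · by_cases hd : sem.defends = true → ∀ a ∈ X s i, ∀ b, F.Adj b a →
          b ∈ attackedBy F (X s i)
        · obtain ⟨E', ⟨hc', hd'⟩, hm⟩ := hE ⟨hc, hd⟩
          exact h'' E' (.inr <| .inr <| .inr <| .inr ⟨hc', hd', hm⟩)
        -- The second set matters only for maximality, so any set serves here.
        · exact h'' ∅ (.inr <| .inr <| .inr <| .inl hd)
      · exact h'' ∅ (.inr <| .inr <| .inl hc)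
    refine ⟨⟨key false, ?_⟩, key true, ?_⟩
    · by_contra hn
      refine h (fun s => cond s ∅ {i}) (fun _ => X false i) (fun _ => attackedBy F (X false i))
        ⟨?_, ?_, fun _ => rfl, ⟨false, i, rfl⟩, .inl ⟨i, rfl, hn⟩⟩
      · rintro (_ | _) <;> simp [hi]
      · rintro (_ | _) <;> simp
    · intro hn
      refine h (fun s => cond s {i} ∅) (fun _ => X true i) (fun _ => attackedBy F (X true i))
        ⟨?_, ?_, fun _ => rfl, ⟨true, i, rfl⟩, .inr <| .inl ⟨i, rfl, hn⟩⟩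
      · rintro (_ | _) <;> simp [hi]
      · rintro (_ | _) <;> simp
  · rintro h P E D ⟨hS, hX, hD, ⟨s, i, hi⟩, hw⟩
    have hE : E false ∈ sem.extensions F := by
      rw [← hX s i hi]
      cases s
      · exact (h i (hS _ hi)).1.1
      · exact (h i (hS _ hi)).2.1
    rw [mem_extensions_iff] at hE
    obtain ⟨⟨hc, hd⟩, hm⟩ := hE
    rw [hD, hD] at hw
    obtain ⟨j, hj, hn⟩ | ⟨j, hj, hn⟩ | hn | hn | ⟨h₁, h₂, h₃⟩ := hw
    · exact hn (hX _ j hj ▸ (h j (hS _ hj)).1.2)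
    · exact (h j (hS _ hj)).2.2 (hX _ j hj ▸ hn)
    · exact hn hc
    · exact hn hd
    · exact hm ⟨E true, ⟨h₁, h₂⟩, h₃⟩

end

/-! ### Binary numbers and encodings -/

namespace Check

theorem testBit_bitsValue (l : List Bool) (j : ℕ) :
    (bitsValue l).testBit j = l[j]?.getD false := by
  induction l generalizing j with
  | nil => simp [bitsValue]
  | cons b l ih =>
    cases j with
    | zero => simp [bitsValue]
    | succ j => simp [bitsValue, Nat.testBit_bit_succ, ih]

/-- A digit list is canonical when its top digit is one; the default `true` admits the empty list.
-/
theorem bits_bitsValue (l : List Bool) (h : l.getLast?.getD true = true) :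
    Nat.bits (bitsValue l) = l := by
  induction l with
  | nil => rfl
  | cons b l ih =>
    have hl : l.getLast?.getD true = true := by
      cases l with
      | nil => rfl
      | cons c l => simpa [List.getLast?_cons_cons] using h
    rw [bitsValue, Nat.bits_append_bit, ih hl]
    intro h0
    obtain rfl : l = [] := by
      rw [h0] at ih
      simpa using (ih hl).symm
    simpa using h

theorem bitsValue_bits_and_getLast (k : ℕ) :
    bitsValue (Nat.bits k) = k ∧ (Nat.bits k).getLast?.getD true = true := by
  induction k using Nat.binaryRec' with
  | zero => simp [bitsValue]
  | bit b n hb ih =>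
    rw [Nat.bits_append_bit _ _ hb]
    refine ⟨by rw [bitsValue, ih.1], ?_⟩
    cases h : n.bits with
    | nil =>
      have : n = 0 := by rw [← ih.1, h]; rfl
      simp [hb this]
    | cons c l =>
      rw [List.getLast?_cons_cons, ← h]
      exact ih.2

/-- Used for `k ≤ n`: the digits of `k` then fit into the additional row of `n` columns. -/
theorem length_bits_le (k : ℕ) : (Nat.bits k).length ≤ k := by
  rw [Nat.size_eq_bits_len, Nat.size_le]
  exact Nat.lt_two_pow_self

theorem flatMap_finRange_eq_ofFn {α : Type*} {n : ℕ} (f : Fin n → Fin n → α) :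
    ((List.finRange n).flatMap fun i => (List.finRange n).map fun j => f i j) =
      List.ofFn fun k : Fin (n * n) => f k.divNat k.modNat := by
  rw [List.ofFn_mul]
  simp only [List.ofFn_eq_map, List.flatMap_def]
  congr 1
  refine List.map_congr_left fun i _ => List.map_congr_left fun j _ => ?_
  congr 1
  · ext
    show (i : ℕ) = (i * n + j) / n
    rw [Nat.mul_comm, Nat.mul_add_div j.pos, Nat.div_eq_of_lt j.isLt, Nat.add_zero]
  · ext
    simp [Fin.modNat, Nat.mod_eq_of_lt]

end Check

end Argumentation

namespace Argumentation

open Complexity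

/-! ### Correctness of the scanner on annotated words. -/

namespace Check

theorem exists_getElem?_ofFn_iff {α : Type*} {n : ℕ} (p : Fin n → α) (φ : ℕ → α → Prop) :
    (∃ i a, (List.ofFn p)[i]? = some a ∧ φ i a) ↔ ∃ i : Fin n, φ i (p i) := by
  constructor
  · rintro ⟨i, a, h, ha⟩
    obtain ⟨hi, rfl⟩ := List.getElem?_eq_some_iff.1 h
    exact ⟨⟨i, by simpa using hi⟩, by simpa using ha⟩
  · rintro ⟨i, hi⟩
    exact ⟨i, p i, by simp, hi⟩

/-- The final state of the scanner. -/
theorem exists_state (sem : Semantics) (d : Bool) (u : List Block) {n : ℕ} (p : Fin n → Block)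
    (hp : (u.takeWhile fun b => b.1.1) = List.ofFn p) (v : List Block)
    (hv : (u.dropWhile fun b => b.1.1).tail = v) :
    ∃ (r : State) (cnt : List Bool), cnt.length = n ∧
      (scanner sem d).result (encodeBlocks u) =
        (!wellFormed r (v.drop (n * n + n)).isEmpty || refuted r) ∧
      (r.skip = true ↔ d = true ∧ (List.ofFn p).countP (fun b => b.1.2.1) = 0) ∧
      bitsValue cnt + d.toNat = (List.ofFn p).countP (fun b => b.1.2.1) + r.skip.toNat ∧
      (v.length ≤ n * n + n →
        r.last = (((v.drop (n * n)).map fun b => b.1.1).getLast?).getD true) ∧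
      ∀ e, r.events e = true ↔
        (∃ i j : Fin n, entryEvent sem (blockBuffer (some (p i))) (blockBuffer (some (p j)))
          (blockBuffer v[n * i + j]?) e = true) ∨
        ∃ (j : Fin n) (f : Bool → Bool),
          (∀ s, f s = true ↔ ∃ i : Fin n, bitAt 2 (blockBuffer v[n * i + j]?) = true ∧
            inSet s (blockBuffer (some (p i))) = true) ∧
          lastEvent (blockBuffer (some (p j)), f, cnt[(j : ℕ)]?.getD false)
            (blockBuffer v[n * n + j]?) e = true := by
  set g : Block → Col := fun b => (blockBuffer (some b), fun _ => false, false) with hg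
  set r₀ : State := ⟨none, fun _ => false, false, d, true⟩ with hr₀
  have hsplit := (scanner sem d).splitPrefix_encodeBlocks u
  rw [hv, hp] at hsplit
  have hqs : List.map (fun b => (scanner sem d).initCol (blockBuffer (some b))) (List.ofFn p) =
    List.ofFn fun i => g (p i) := by rw [List.map_ofFn]; rfl
  rw [hqs] at hsplit
  have hres : (scanner sem d).result (encodeBlocks u) =
      (let t := scanAll (entry sem) newRow (List.ofFn fun i => g (p i)) r₀
        (List.ofFn fun i => g (p i)) (encodeBlocks v)
      (!wellFormed t.1 t.2.2.isEmpty || refuted t.1)) := by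
    unfold Scanner.result
    rw [hsplit]
    rfl
  have hzero : bitsValue ((List.ofFn fun i => g (p i)).map fun q => q.2.2) = 0 := by
    have (m : ℕ) : bitsValue (List.replicate m false) = 0 := by
      induction m with
      | zero => rfl
      | succ m ih => simp [List.replicate_succ, bitsValue, ih]
    rw [List.map_ofFn, ← this n]
    congr 1
    exact List.ofFn_const n false
  -- The counter starts at zero and there are `n < 2 ^ n` rows, so it does not overflow.
  obtain ⟨h₁, h₂, h₃, h₄, h₅, h₆, h₇⟩ := scanRows_eq sem r₀ (List.ofFn fun i => g (p i))
    (List.ofFn fun i => g (p i)) (encodeBlocks v) (by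
      rw [hzero]; simpa using Nat.lt_two_pow_self)
  simp only [scanAll] at hres
  set t := scanRows (entry sem) newRow (List.ofFn fun i => g (p i)) r₀
    (List.ofFn fun i => g (p i)) (encodeBlocks v) with ht
  simp only [List.length_ofFn] at h₁ h₂ h₄ h₅
  rw [drop_encodeBlocks] at h₂
  obtain ⟨k₁, k₂, k₃, k₄⟩ := scanRow_of_label_eq_none sem (newRow t.1 none) rfl t.2.1
    (v.drop (n * n))
  rw [← h₂] at k₁ k₂ k₃ k₄
  have hcount : (List.ofFn fun i => g (p i)).countP (fun c => selected c.1) =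
      (List.ofFn p).countP fun b => b.1.2.1 := by
    have : (List.ofFn fun i => g (p i)) = (List.ofFn p).map g := by rw [List.map_ofFn]; rfl
    rw [this, List.countP_map]
    rfl
  refine ⟨(scanRow (entry sem) (newRow t.1 none) t.2.1 t.2.2).1, t.2.1.map fun q => q.2.2,
    by simpa using h₁, ?_, ?_, ?_, fun hl => ?_, fun e => ?_⟩
  · rw [hres, k₁, isEmpty_encodeBlocks, h₁, List.drop_drop]
  · rw [k₂, ← hcount]
    exact h₆
  · rw [k₂, ← hcount]
    rw [hzero, zero_add] at h₇
    exact h₇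
  · rw [k₃ (by rw [h₁, List.length_drop]; omega)]
    congr 1
  · rw [k₄]
    have hev : (newRow t.1 none).events = t.1.events := rfl
    rw [hev, h₄]
    simp only [readBuffer_drop_encodeBlocks] at h₅ ⊢
    have hget (i : Fin n) : (List.ofFn fun i => g (p i))[(i : ℕ)]? = some (g (p i)) := by simp
    have hcol (j : Fin n) : ∃ f : Bool → Bool,
        t.2.1[(j : ℕ)]? = some (blockBuffer (some (p j)), f,
          (t.2.1.map fun q => q.2.2)[(j : ℕ)]?.getD false) ∧
        ∀ s, f s = true ↔ ∃ i : Fin n, bitAt 2 (blockBuffer v[n * i + j]?) = true ∧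
            inSet s (blockBuffer (some (p i))) = true := by
      obtain ⟨f, k, hf, hf'⟩ := h₅ j _ (hget j)
      refine ⟨f, by simp [hf, hg], fun s => ?_⟩
      rw [hf', exists_getElem?_ofFn_iff (fun i => g (p i)) fun i c =>
        bitAt 2 (blockBuffer v[n * i + j]?) = true ∧ inSet s c.1 = true]
      simp [hg]
    refine or_congr ?_ ?_
    · constructor
      · rintro (h | ⟨i, c, j, q, hi, hj, h⟩)
        · exact absurd h (by simp [hr₀])
        · obtain ⟨hi', rfl⟩ := List.getElem?_eq_some_iff.1 hi
          obtain ⟨hj', rfl⟩ := List.getElem?_eq_some_iff.1 hj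
          refine ⟨⟨i, by simpa using hi'⟩, ⟨j, by simpa using hj'⟩, ?_⟩
          simpa using h
      · rintro ⟨i, j, h⟩
        exact Or.inr ⟨i, _, j, _, hget i, hget j, h⟩
    · simp only [List.getElem?_drop]
      constructor
      · rintro ⟨j, q, hj, h⟩
        have hj' : j < n := h₁ ▸ (List.getElem?_eq_some_iff.1 hj).1
        obtain ⟨f, hf, hf'⟩ := hcol ⟨j, hj'⟩
        obtain rfl := Option.some.inj (hf.symm.trans hj)
        exact ⟨⟨j, hj'⟩, f, hf', h⟩
      · rintro ⟨j, f, hf, h⟩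
        obtain ⟨f', hf', hf''⟩ := hcol j
        obtain rfl : f = f' := by
          funext s
          rw [Bool.eq_iff_iff, hf, hf'']
        exact ⟨j, _, hf', h⟩

/-- The word with the prefix `a` (before the first zero) and the rest `b` (after the first zero) is
the encoding of a framework and a number `k`, and `k + d` arguments are selected. -/
def WellFormed (d : Bool) (n : ℕ) (a b : List (Bool × Bool × Bool)) : Prop :=
  0 < n ∧ n * n ≤ b.length ∧ b.length ≤ n * n + n ∧
    (((b.drop (n * n)).map Prod.fst).getLast?).getD true = true ∧
    bitsValue ((b.drop (n * n)).map Prod.fst) + d.toNat = a.countP fun t => t.2.1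

/-- The framework given by a list of entries. -/
def frame (n : ℕ) (b : List (Bool × Bool × Bool)) : AF (Fin n) :=
  ⟨fun i j => (b.getD (n * i + j) default).1 = true⟩

/-- The selected arguments. -/
def selection (n : ℕ) (a : List (Bool × Bool × Bool)) : Set (Fin n) :=
  {i | (a.getD i default).2.1 = true}

/-- The proposed extensions. -/
def proposal (n : ℕ) (b : List (Bool × Bool × Bool)) (s : Bool) (i : Fin n) : Set (Fin n) :=
  {j | cond s (b.getD (n * i + j) default).2.2 (b.getD (n * i + j) default).2.1 = true}

theorem bitsValue_eq_iff (l l' : List Bool) (n : ℕ) (hl : l.length ≤ n) (hl' : l'.length ≤ n) :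
    bitsValue l = bitsValue l' ↔ ∀ j : Fin n, l[(j : ℕ)]?.getD false = l'[(j : ℕ)]?.getD false := by
  constructor
  · intro h j
    rw [← testBit_bitsValue, ← testBit_bitsValue, h]
  · intro h
    refine Nat.eq_of_testBit_eq fun j => ?_
    rw [testBit_bitsValue, testBit_bitsValue]
    by_cases hj : j < n
    · exact h ⟨j, hj⟩
    · rw [List.getElem?_eq_none (by omega), List.getElem?_eq_none (by omega)]

/-- The second-round bits of the prefix encode `P`, `E` and `D`, and the events correspond to the
clauses of `Refutes`. Conditions on a single argument are tested at all entries of its row, so the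
diagonal entry can witness them. -/
theorem result_eq_false_iff (sem : Semantics) (d : Bool) (u : List Block) {n : ℕ}
    (p : Fin n → Block) (hp : (u.takeWhile fun b => b.1.1) = List.ofFn p) (v : List Block)
    (hv : (u.dropWhile fun b => b.1.1).tail = v) :
    (scanner sem d).result (encodeBlocks u) = false ↔
      WellFormed d n ((List.ofFn p).map Prod.fst) (v.map Prod.fst) ∧
      ¬ Refutes sem (frame n (v.map Prod.fst)) (selection n ((List.ofFn p).map Prod.fst))
        (proposal n (v.map Prod.fst)) (fun s => {i | (p i).2 (cond s 1 0) = true})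
        (fun s => {i | (p i).2 (cond s 4 2) = true})
        (fun s => {i | (p i).2 (cond s 5 3) = true}) := by
  obtain ⟨r, cnt, hlen, hres, hskip, hcnt, hlast, hev⟩ := exists_state sem d u p hp v hv
  have hwf : wellFormed r (v.drop (n * n + n)).isEmpty = true ↔
      WellFormed d n ((List.ofFn p).map Prod.fst) (v.map Prod.fst) := by
    have hne : r.events .nonempty = true ↔ 0 < n := by
      rw [hev]
      constructor
      · rintro (⟨i, -⟩ | ⟨i, -⟩) <;> exact i.pos
      · exact fun h => .inl ⟨⟨0, h⟩, ⟨0, h⟩, rfl⟩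
    have hmal : 0 < n → v.length ≤ n * n + n → (r.events .malformed = false ↔ n * n ≤ v.length ∧
        bitsValue ((v.drop (n * n)).map fun b => b.1.1) = bitsValue cnt) := by
      intro hn hvl
      rw [bitsValue_eq_iff _ _ n (by simp; omega) hlen.le, ← Bool.not_eq_true, hev, not_or]
      refine and_congr ?_ ?_
      · constructor
        · intro h
          by_contra hlt
          -- If any entry is missing, then so is the last one, at index `n * n - 1`.
          refine h ⟨⟨n - 1, by omega⟩, ⟨n - 1, by omega⟩, ?_⟩
          have : v.length ≤ n * (n - 1) + (n - 1) := by
            obtain ⟨m, rfl⟩ : ∃ m, n = m + 1 := ⟨n - 1, by omega⟩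
            simp only [Nat.add_sub_cancel]
            nlinarith
          simp [entryEvent, List.getElem?_eq_none this, blockBuffer]
        · rintro h ⟨i, j, hij⟩
          have : n * i + j < v.length := by
            have := i.isLt
            have := j.isLt
            nlinarith
          simp [entryEvent, List.getElem?_eq_getElem this, blockBuffer, encodeBlock] at hij
      · have hbit (j : ℕ) : bitAt 2 (blockBuffer v[n * n + j]?) =
            (((v.drop (n * n)).map fun b => b.1.1)[j]?).getD false := by
          rw [List.getElem?_map, List.getElem?_drop]
          cases v[n * n + j]? <;> rfl
        constructor
        · intro h j
          rw [← hbit]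
          by_contra hne
          classical
          refine h ⟨j, fun s => decide (∃ i : Fin n, bitAt 2 (blockBuffer v[n * i + j]?) = true ∧
            inSet s (blockBuffer (some (p i))) = true), fun s => by simp, ?_⟩
          simpa [lastEvent] using hne
        · rintro h ⟨j, f, -, hj⟩
          simp only [lastEvent, hbit, h j, bne_self_eq_false, Bool.false_eq_true] at hj
    simp only [wellFormed, Bool.and_eq_true, Bool.not_eq_true', List.isEmpty_iff,
      List.drop_eq_nil_iff, WellFormed, List.length_map, hne]
    have hmap : ((v.map Prod.fst).drop (n * n)).map Prod.fst =
        (v.drop (n * n)).map fun b => b.1.1 := by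
      rw [← List.map_drop, List.map_map]; rfl
    have hcp : ((List.ofFn p).map Prod.fst).countP (fun t => t.2.1) =
        (List.ofFn p).countP fun b => b.1.2.1 := by
      rw [List.countP_map]; rfl
    rw [hmap, hcp]
    constructor
    · rintro ⟨⟨⟨⟨h₁, h₂⟩, h₃⟩, h₄⟩, h₅⟩
      obtain ⟨h₆, h₇⟩ := (hmal h₁ h₃).1 h₂
      rw [h₅] at hcnt
      exact ⟨h₁, h₆, h₃, by rw [← hlast h₃, h₄], by rw [h₇]; simpa using hcnt⟩
    · rintro ⟨h₁, h₂, h₃, h₄, h₅⟩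
      -- A pending `skip` would mean `d = true` with nothing selected, whereas the count must be at
      -- least `d`.
      have hs : r.skip = false := by
        by_contra hs
        obtain ⟨hd, h0⟩ := hskip.1 (by simpa using hs)
        simp [hd, h0] at h₅
      rw [hs] at hcnt
      simp only [Bool.toNat_false] at hcnt
      exact ⟨⟨⟨⟨h₁, (hmal h₁ h₃).2 ⟨h₂, by omega⟩⟩, h₃⟩, by rw [hlast h₃, h₄]⟩, hs⟩
  rw [hres]
  simp only [Bool.or_eq_false_iff, Bool.not_eq_false', hwf]
  refine and_congr_right fun hw => ?_
  rw [← Bool.not_eq_true]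
  refine not_congr ?_
  obtain ⟨hn, hvl, -⟩ := hw
  rw [List.length_map] at hvl
  have hidx (i j : Fin n) : n * i + j < v.length := by
    have := i.isLt
    have := j.isLt
    nlinarith
  obtain ⟨c, hc⟩ : ∃ c : Fin n → Fin n → Block, ∀ i j : Fin n, v[n * (i : ℕ) + j]? = some (c i j) :=
    ⟨fun i j => v[n * (i : ℕ) + j]'(hidx i j), fun i j => List.getElem?_eq_getElem (hidx i j)⟩
  have hc' (i j : Fin n) : (v.map Prod.fst).getD (n * i + j) default = (c i j).1 := by
    simp [List.getD_eq_getElem?_getD, hc]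
  have hp' (i : Fin n) : ((List.ofFn p).map Prod.fst).getD i default = (p i).1 := by
    simp [List.getD_eq_getElem?_getD]
  have hadj : (frame n (v.map Prod.fst)).Adj = fun i j => (c i j).1.1 = true := by
    funext i j
    simp only [frame, hc']
  have hsel : selection n ((List.ofFn p).map Prod.fst) = {i | (p i).1.2.1 = true} := by
    simp only [selection, hp']
  have hprop : proposal n (v.map Prod.fst) =
      fun s i => {j | cond s (c i j).1.2.2 (c i j).1.2.1 = true} := by
    funext s i
    simp only [proposal, hc']
  generalize frame n (v.map Prod.fst) = F at hadj ⊢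
  rw [hsel, hprop]
  simp only [hc] at hev
  have b₁ (s : Bool) (b : Block) : inSet s (blockBuffer (some b)) = b.2 (cond s 4 2) := by
    cases s <;> rfl
  have b₂ (s : Bool) (b : Block) : attacked s (blockBuffer (some b)) = b.2 (cond s 5 3) := by
    cases s <;> rfl
  have b₃ (s : Bool) (b : Block) : mark s (blockBuffer (some b)) = b.2 (cond s 1 0) := by
    cases s <;> rfl
  have b₄ (b : Block) : selected (blockBuffer (some b)) = b.1.2.1 := rfl
  have b₅ (b : Block) : bitAt 2 (blockBuffer (some b)) = b.1.1 := rfl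
  have b₆ (s : Bool) (b : Block) : witness s (blockBuffer (some b)) =
      cond s b.1.2.2 b.1.2.1 := by
    cases s <;> rfl
  generalize hP : (fun (s : Bool) => {i | (p i).2 (cond s 1 0) = true}) = P
  generalize hE : (fun (s : Bool) => {i | (p i).2 (cond s 4 2) = true}) = E
  generalize hD : (fun (s : Bool) => {i | (p i).2 (cond s 5 3) = true}) = D
  have mP (s : Bool) (i : Fin n) : i ∈ P s ↔ (p i).2 (cond s 1 0) = true := by rw [← hP]; rfl
  have mE (s : Bool) (i : Fin n) : i ∈ E s ↔ (p i).2 (cond s 4 2) = true := by rw [← hE]; rfl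
  have mD (s : Bool) (i : Fin n) : i ∈ D s ↔ (p i).2 (cond s 5 3) = true := by rw [← hD]; rfl
  have mM (s : Bool) (i : Fin n) : i ∈ sem.measure (E s) (D s) ↔
      sem.counts ((p i).2 (cond s 4 2)) ((p i).2 (cond s 5 3)) = true := by
    simp only [Semantics.measure, Set.mem_ofPred_eq, mE, mD, Bool.decide_eq_true]
  have mA (i j : Fin n) : F.Adj i j ↔ (c i j).1.1 = true := by rw [hadj]
  have hmk : r.events .marked = true ↔ ∃ s, (P s).Nonempty := by
    rw [hev]
    simp only [entryEvent, lastEvent, b₃, Bool.false_eq_true, and_false, exists_false, or_false,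
      Bool.or_eq_true, Bool.exists_bool, Set.Nonempty, mP, cond_true, cond_false, ← exists_or]
    exact ⟨fun ⟨i, _, h⟩ => ⟨i, h⟩, fun ⟨i, h⟩ => ⟨i, i, h⟩⟩
  have hst : r.events .strict = true ↔
      ¬ sem.measure (E true) (D true) ⊆ sem.measure (E false) (D false) := by
    rw [hev, Set.not_subset]
    simp only [entryEvent, lastEvent, b₁, b₂, Bool.false_eq_true, and_false, exists_false,
      or_false, Bool.and_eq_true, Bool.not_eq_true', mM, Bool.not_eq_true]
    exact ⟨fun ⟨i, _, h⟩ => ⟨i, h.2, h.1⟩, fun ⟨i, h⟩ => ⟨i, i, h.2, h.1⟩⟩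
  have hnr : r.events .notRefuting = false ↔ ConflictFree F (E true) ∧
      (sem.defends = true → ∀ a ∈ E true, ∀ b, F.Adj b a → b ∈ D true) ∧
      sem.measure (E false) (D false) ⊆ sem.measure (E true) (D true) := by
    rw [← Bool.not_eq_true, hev]
    simp only [entryEvent, lastEvent, b₁, b₂, b₅, Bool.false_eq_true, and_false, exists_false,
      or_false, Bool.and_eq_true, Bool.not_eq_true', Bool.or_eq_true, ConflictFree, Set.subset_def,
      mM, mA, mE, mD, not_exists, not_or, not_and, and_imp, Bool.not_eq_false]
    constructor
    · intro h
      exact ⟨fun i hi j hj hij => (h i j).1.1 hij hi hj,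
        fun hd a ha b hb => (h b a).1.2 hd hb ha, fun i hi => (h i i).2 hi⟩
    · rintro ⟨h₁, h₂, h₃⟩ i j
      exact ⟨⟨fun hij hi hj => h₁ i hi j hj hij, fun hd hij hj => h₂ hd j hj i hij⟩, h₃ i⟩
  have hwr : r.events .wrong = true ↔ (∃ i ∈ P false, i ∉ E false) ∨
      (∃ i ∈ P true, i ∈ E false) ∨ ¬ ConflictFree F (E false) ∨
      ¬ (sem.defends = true → ∀ a ∈ E false, ∀ b, F.Adj b a → b ∈ D false) := by
    rw [hev]
    simp only [entryEvent, lastEvent, b₁, b₂, b₃, b₅, Bool.false_eq_true, and_false, exists_false,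
      or_false, Bool.and_eq_true, Bool.not_eq_true', Bool.or_eq_true, ConflictFree,
      mP, mA, mE, mD, not_forall, Bool.not_eq_true, Bool.not_eq_false]
    constructor
    · rintro ⟨i, j, ((h | h) | h) | h⟩
      · exact .inl ⟨i, h⟩
      · exact .inr <| .inl ⟨i, h⟩
      · exact .inr <| .inr <| .inl ⟨i, h.1.2, j, h.2, h.1.1⟩
      · exact .inr <| .inr <| .inr ⟨h.1.1.1, j, h.1.2, i, h.1.1.2, h.2⟩
    · rintro (⟨i, h⟩ | ⟨i, h⟩ | ⟨i, hi, j, hj, h⟩ | ⟨hd, j, hj, i, hi, h⟩)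
      · exact ⟨i, i, .inl <| .inl <| .inl h⟩
      · exact ⟨i, i, .inl <| .inl <| .inr h⟩
      · exact ⟨i, j, .inl <| .inr ⟨⟨h, hi⟩, hj⟩⟩
      · exact ⟨i, j, .inr ⟨⟨⟨hd, hi⟩, hj⟩, h⟩⟩
  have hin : r.events .inconsistent = false ↔ (∀ s, P s ⊆ {i | (p i).1.2.1 = true}) ∧
      (∀ s, ∀ i ∈ P s, {j | cond s (c i j).1.2.2 (c i j).1.2.1 = true} = E false) ∧
      ∀ s, D s = attackedBy F (E s) := by
    have hf (j : Fin n) (f : Bool → Bool) : (∀ s, f s = true ↔ ∃ i : Fin n,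
        bitAt 2 (blockBuffer (some (c i j))) = true ∧
          inSet s (blockBuffer (some (p i))) = true) ↔
        ∀ s, f s = true ↔ j ∈ attackedBy F (E s) := by
      simp only [attackedBy, Set.mem_ofPred_eq, mE, mA, b₁, b₅, and_comm]
    rw [← Bool.not_eq_true, hev]
    simp only [hf]
    rw [not_or, ← and_assoc]
    refine and_congr ?_ ?_
    · simp only [entryEvent, b₁, b₃, b₄, b₆, Bool.and_eq_true, Bool.not_eq_true', Bool.or_eq_true,
        bne_iff_ne, ne_eq, not_exists, not_or, not_and, not_not, Set.subset_def, Set.ext_iff,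
        Set.mem_ofPred_eq, mP, mE, Bool.forall_bool, cond_true, cond_false, Bool.not_eq_false]
      constructor
      · intro h
        refine ⟨⟨fun i hi => (h i i).1.1 (.inl hi), fun i hi => (h i i).1.1 (.inr hi)⟩,
          fun i hi j => ?_, fun i hi j => ?_⟩
        · rw [(h i j).1.2 hi]
        · rw [(h i j).2 hi]
      · rintro ⟨⟨h₁, h₂⟩, h₃, h₄⟩ i j
        refine ⟨⟨fun hi => hi.elim (h₁ i) (h₂ i), fun hi => ?_⟩, fun hi => ?_⟩
        · rw [Bool.eq_iff_iff, h₃ i hi]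
        · rw [Bool.eq_iff_iff, h₄ i hi]
    · simp only [lastEvent, b₂, Bool.or_eq_true, bne_iff_ne, ne_eq, not_exists, not_and, not_or,
        not_not]
      constructor
      · intro h s
        ext j
        classical
        have := h j (fun s => decide (j ∈ attackedBy F (E s))) (by simp)
        rw [mD]
        cases s
        · rw [cond_false] at this ⊢
          rw [← this.1]; simp
        · rw [cond_true] at this ⊢
          rw [← this.2]; simp
      · intro h j f hf'
        constructor
        · rw [Bool.eq_iff_iff, hf', ← h, mD]
        · rw [Bool.eq_iff_iff, hf', ← h, mD]
  simp only [refuted, Bool.and_eq_true, Bool.or_eq_true, Bool.not_eq_true', hin, hmk, hwr, hnr, hst,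
    Refutes, ssubset_iff_subset_not_subset, and_assoc, or_assoc]

end Check

end Argumentation

/-! ### From certificates to facets. -/

namespace Argumentation

open Complexity

namespace Check

theorem eq_ofFn_getElem {α : Type*} {n : ℕ} (l : List α) (h : l.length = n) :
    l = List.ofFn fun i : Fin n => l[i] := by
  subst h
  exact List.ofFn_getElem.symm

/-- As `u` runs through the annotations of `l`, the bits in the prefix realize every choice of `P`,
`E`, `D`, since there is one block for each argument. -/
theorem forall_result_eq_false_iff (sem : Semantics) (d : Bool) (l : List (Bool × Bool × Bool))
    {n : ℕ} (hn : (l.takeWhile Prod.fst).length = n) :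
    (∀ u : List Block, u.map Prod.fst = l → (scanner sem d).result (encodeBlocks u) = false) ↔
      WellFormed d n (l.takeWhile Prod.fst) (l.dropWhile Prod.fst).tail ∧
      ∀ P E D, ¬ Refutes sem (frame n (l.dropWhile Prod.fst).tail)
        (selection n (l.takeWhile Prod.fst)) (proposal n (l.dropWhile Prod.fst).tail) P E D := by
  have htake (u : List Block) (hu : u.map Prod.fst = l) :
      (u.takeWhile fun b => b.1.1).map Prod.fst = l.takeWhile Prod.fst := by
    rw [← hu, List.takeWhile_map]; rfl
  have hdrop (u : List Block) (hu : u.map Prod.fst = l) :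
      (u.dropWhile fun b => b.1.1).tail.map Prod.fst = (l.dropWhile Prod.fst).tail := by
    rw [← hu, List.dropWhile_map, List.map_tail]; rfl
  have key (u : List Block) (hu : u.map Prod.fst = l) (p : Fin n → Block)
      (hp : (u.takeWhile fun b => b.1.1) = List.ofFn p) := by
    have h := result_eq_false_iff sem d u p hp _ rfl
    rw [← hp, htake u hu, hdrop u hu] at h
    exact h
  constructor
  · intro h
    have h' (P E D : Bool → Set (Fin n)) :
        WellFormed d n (l.takeWhile Prod.fst) (l.dropWhile Prod.fst).tail ∧
        ¬ Refutes sem (frame n (l.dropWhile Prod.fst).tail)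
          (selection n (l.takeWhile Prod.fst)) (proposal n (l.dropWhile Prod.fst).tail) P E D := by
      classical
      set p : Fin n → Block := fun i => ((l.takeWhile Prod.fst)[i],
        ![decide (i ∈ P false), decide (i ∈ P true), decide (i ∈ E false), decide (i ∈ D false),
          decide (i ∈ E true), decide (i ∈ D true)]) with hp
      -- Second-round bits after the prefix are irrelevant and set to `false`.
      set u : List Block := List.ofFn p ++ (l.dropWhile Prod.fst).map fun t => (t, fun _ => false)
        with hu
      have hul : u.map Prod.fst = l := by
        rw [hu, List.map_append, List.map_map, List.map_ofFn]
        have : Prod.fst ∘ p = fun i => (l.takeWhile Prod.fst)[i] := rfl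
        rw [this, ← eq_ofFn_getElem _ hn]
        have : (Prod.fst ∘ fun t : Bool × Bool × Bool => (t, fun _ : Fin 6 => false)) = id := rfl
        rw [this, List.map_id, List.takeWhile_append_dropWhile]
      have hup : (u.takeWhile fun b => b.1.1) = List.ofFn p := by
        have hl : (u.takeWhile fun b => b.1.1).length = n := by
          rw [← hn, ← htake u hul, List.length_map]
        rw [List.prefix_iff_eq_take.1 (List.takeWhile_prefix _), hl, hu]
        exact List.take_left' (by simp)
      have hk := (key u hul p hup).1 (h u hul)
      have e₁ : (fun s : Bool => {i | (p i).2 (cond s 1 0) = true}) = P := by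
        funext s; ext i; cases s <;> simp [hp]
      have e₂ : (fun s : Bool => {i | (p i).2 (cond s 4 2) = true}) = E := by
        funext s; ext i; cases s <;> simp [hp]
      have e₃ : (fun s : Bool => {i | (p i).2 (cond s 5 3) = true}) = D := by
        funext s; ext i; cases s <;> simp [hp]
      rwa [e₁, e₂, e₃] at hk
    exact ⟨(h' (fun _ => ∅) (fun _ => ∅) (fun _ => ∅)).1, fun P E D => (h' P E D).2⟩
  · rintro ⟨hw, hr⟩ u hu
    have hl : (u.takeWhile fun b => b.1.1).length = n := by
      rw [← hn, ← htake u hu, List.length_map]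
    exact (key u hu _ (eq_ofFn_getElem _ hl)).2 ⟨hw, hr _ _ _⟩

theorem ncard_selection {n : ℕ} (a : List (Bool × Bool × Bool)) (ha : a.length = n) :
    (selection n a).ncard = a.countP fun t => t.2.1 := by
  have h : selection n a = {i : Fin n | a[i].2.1 = true} := by
    ext i
    simp [selection, List.getD_eq_getElem?_getD, ha]
  rw [h, Set.ncard_eq_toFinset_card', Set.toFinset_ofPred]
  conv_rhs => rw [eq_ofFn_getElem a ha, List.ofFn_eq_map, List.countP_map]
  have hu : (Finset.univ : Finset (Fin n)).val = ↑(List.finRange n) := rfl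
  rw [List.countP_eq_length_filter, Finset.card_def, Finset.filter_val, hu, Multiset.filter_coe,
    Multiset.coe_card]
  congr 2
  funext i
  simp

theorem encodeInstance_eq {n : ℕ} (F : AF (Fin n)) (k : ℕ) [∀ i j, Decidable (F.Adj i j)] :
    encodeInstance F k = List.replicate n true ++ false ::
      ((List.ofFn fun m : Fin (n * n) => decide (F.Adj m.divNat m.modNat)) ++ Nat.bits k) := by
  rw [encodeInstance, flatMap_finRange_eq_ofFn fun i j => _]
  simp only [List.append_assoc, List.cons_append, List.nil_append]
  congr!

/-- The unary prefix determines `n`, hence where the matrix ends and the digits begin. This is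
needed because membership in `atLeastFacets` quantifies over decodings, and `exactFacets_eq` negates
it. -/
theorem eq_of_encodeInstance_eq {n n' : ℕ} {F : AF (Fin n)} {F' : AF (Fin n')} {k k' : ℕ}
    (h : encodeInstance F k = encodeInstance F' k') (sem : Semantics) :
    (facets sem F).ncard = (facets sem F').ncard ∧ k = k' := by
  classical
  rw [encodeInstance_eq, encodeInstance_eq] at h
  have hn : n = n' := by
    have := congrArg (fun w => (w.takeWhile id).length) h
    simpa [List.takeWhile_append, List.takeWhile_replicate] using this
  subst hn
  rw [List.append_cancel_left_eq, List.cons.injEq] at h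
  obtain ⟨h₁, h₂⟩ := List.append_inj h.2 (by simp)
  have hk : k = k' := by
    rw [← (bitsValue_bits_and_getLast k).1, h₂, (bitsValue_bits_and_getLast k').1]
  have hF : F = F' := by
    have h₃ := List.ofFn_injective h₁
    ext i j
    have := congrFun h₃ (finProdFinEquiv (i, j))
    have e₁ : (finProdFinEquiv (i, j)).divNat = i :=
      congrArg Prod.fst (finProdFinEquiv.symm_apply_apply (i, j))
    have e₂ : (finProdFinEquiv (i, j)).modNat = j :=
      congrArg Prod.snd (finProdFinEquiv.symm_apply_apply (i, j))
    simpa [e₁, e₂] using this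
  exact ⟨by rw [hF], hk⟩

end Check

open Check

/-- The instances for which there are at least `k` facets, or at least `k + 1` if `d` is true. -/
def atLeastFacets (sem : Semantics) (d : Bool) : Lang :=
  {w | ∃ n : ℕ, 0 < n ∧ ∃ (F : AF (Fin n)) (k : ℕ),
    w = encodeInstance F k ∧ k + d.toNat ≤ (facets sem F).ncard}

theorem mem_facets_iff {A : Type*} (sem : Semantics) (F : AF A) (i : A) :
    i ∈ facets sem F ↔ ∃ X : Bool → Set A, (X false ∈ sem.extensions F ∧ i ∈ X false) ∧
      (X true ∈ sem.extensions F ∧ i ∉ X true) := by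
  simp only [facets, cred, skep, Set.mem_sdiff, Set.mem_ofPred_eq, not_forall]
  constructor
  · rintro ⟨⟨E, hE, hi⟩, E', hE', hi'⟩
    exact ⟨fun s => cond s E' E, ⟨hE, hi⟩, hE', hi'⟩
  · rintro ⟨X, ⟨h₁, h₂⟩, h₃, h₄⟩
    exact ⟨⟨_, h₁, h₂⟩, _, h₃, h₄⟩

/-- The tests of form leave no freedom: the prefix is unary, a zero follows, the matrix is complete,
and the remaining digits are canonical. -/
theorem encodeInstance_frame (d : Bool) (l : List (Bool × Bool × Bool)) {n : ℕ}
    (hn : (l.takeWhile Prod.fst).length = n)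
    (hw : WellFormed d n (l.takeWhile Prod.fst) (l.dropWhile Prod.fst).tail) :
    l.map Prod.fst = encodeInstance (frame n (l.dropWhile Prod.fst).tail)
      (bitsValue (((l.dropWhile Prod.fst).tail.drop (n * n)).map Prod.fst)) := by
  classical
  obtain ⟨h₁, h₂, h₃, h₄, -⟩ := hw
  rw [encodeInstance_eq, bits_bitsValue _ h₄]
  have hpre : (l.takeWhile Prod.fst).map Prod.fst = List.replicate n true := by
    rw [List.eq_replicate_iff]
    refine ⟨by simpa using hn, fun b hb => ?_⟩
    obtain ⟨t, ht, rfl⟩ := List.mem_map.1 hb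
    exact List.mem_takeWhile_imp ht
  conv_lhs => rw [← List.takeWhile_append_dropWhile (p := Prod.fst) (l := l)]
  rw [List.map_append, hpre, List.append_cancel_left_eq]
  cases hd : l.dropWhile Prod.fst with
  -- Without a separating zero nothing would be left for the `n * n > 0` entries.
  | nil =>
    rw [hd] at h₂
    have := Nat.mul_pos h₁ h₁
    simp at h₂
    omega
  | cons t b =>
    have ht : t.1 = false := by
      have := List.head_dropWhile_not Prod.fst (l := l) (by simp [hd])
      simpa [hd] using this
    rw [hd, List.tail_cons] at h₂
    rw [List.map_cons, ht, List.tail_cons, List.cons.injEq]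
    refine ⟨rfl, ?_⟩
    conv_lhs => rw [← List.take_append_drop (n * n) b]
    rw [List.map_append, List.append_cancel_right_eq]
    refine List.ext_getElem (by simp [h₂]) fun m hm hm' => ?_
    have hm'' : m < n * n := by simpa using hm'
    have hlt : m < b.length := hm''.trans_le h₂
    have hdiv : n * (m / n) + m % n = m := Nat.div_add_mod m n
    simp [frame, Fin.divNat, Fin.modNat, hdiv, List.getD_eq_getElem?_getD, hlt]

/-- The membership bits of `S` annotate the prefix, and entry `(i, j)` is annotated with whether `j`
lies in `X false i` and in `X true i`. -/
theorem exists_wellFormed (d : Bool) {n : ℕ} (h0 : 0 < n) (F : AF (Fin n)) (k : ℕ)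
    (S : Set (Fin n)) (hS : S.ncard = k + d.toNat) (X : Bool → Fin n → Set (Fin n)) :
    ∃ l : List (Bool × Bool × Bool), l.map Prod.fst = encodeInstance F k ∧
      (l.takeWhile Prod.fst).length = n ∧
      WellFormed d n (l.takeWhile Prod.fst) (l.dropWhile Prod.fst).tail ∧
      frame n (l.dropWhile Prod.fst).tail = F ∧ selection n (l.takeWhile Prod.fst) = S ∧
      proposal n (l.dropWhile Prod.fst).tail = X := by
  classical
  set a : List (Bool × Bool × Bool) := List.ofFn fun i : Fin n => (true, decide (i ∈ S), false)
    with ha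
  set m : List (Bool × Bool × Bool) := List.ofFn fun m : Fin (n * n) =>
    (decide (F.Adj m.divNat m.modNat), decide (m.modNat ∈ X false m.divNat),
      decide (m.modNat ∈ X true m.divNat)) with hm
  set b := m ++ (Nat.bits k).map fun c => (c, false, false) with hb
  have hat : ∀ t ∈ a, t.1 = true := by
    intro t ht
    obtain ⟨i, rfl⟩ := (List.mem_ofFn' _ _).1 ht
    rfl
  have hta : (a ++ (false, false, false) :: b).takeWhile Prod.fst = a := by
    rw [List.takeWhile_append_of_pos hat]; simp
  have htb : ((a ++ (false, false, false) :: b).dropWhile Prod.fst).tail = b := by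
    rw [List.dropWhile_append_of_pos hat]; simp
  have hget (i j : Fin n) : b.getD (n * i + j) default =
      (decide (F.Adj i j), decide (j ∈ X false i), decide (j ∈ X true i)) := by
    have hlt : n * (i : ℕ) + j < n * n := by
      have := i.isLt
      have := j.isLt
      nlinarith
    have e₁ : (⟨n * (i : ℕ) + j, hlt⟩ : Fin (n * n)).divNat = i := by
      ext
      show (n * (i : ℕ) + j) / n = i
      rw [Nat.mul_add_div j.pos, Nat.div_eq_of_lt j.isLt, Nat.add_zero]
    have e₂ : (⟨n * (i : ℕ) + j, hlt⟩ : Fin (n * n)).modNat = j := by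
      ext
      show (n * (i : ℕ) + j) % n = j
      rw [Nat.mul_add_mod, Nat.mod_eq_of_lt j.isLt]
    rw [List.getD_eq_getElem?_getD, hb, List.getElem?_append_left (by simpa [hm] using hlt), hm,
      List.getElem?_ofFn, dif_pos hlt, e₁, e₂]
    rfl
  have hsel : selection n a = S := by
    ext i
    simp [selection, ha, List.getD_eq_getElem?_getD]
  refine ⟨a ++ (false, false, false) :: b, ?_, ?_, ?_, ?_, ?_, ?_⟩
  · rw [encodeInstance_eq]
    simp [ha, hb, hm, List.map_ofFn, Function.comp_def, List.ofFn_const]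
  · rw [hta]; simp [ha]
  · rw [hta, htb]
    have hdrop : (b.drop (n * n)).map Prod.fst = Nat.bits k := by
      rw [hb, List.drop_left' (by simp [hm])]
      simp [Function.comp_def]
    obtain ⟨hk₁, hk₂⟩ := bitsValue_bits_and_getLast k
    -- Here `k ≤ S.ncard ≤ n`.
    have hle : (Nat.bits k).length ≤ n := by
      have h₁ := length_bits_le k
      have h₂ := Set.ncard_le_card S
      simp at h₂
      omega
    refine ⟨h0, by simp [hb, hm], by simp [hb, hm, hle], by rw [hdrop, hk₂], ?_⟩
    rw [hdrop, hk₁, ← hS, ← ncard_selection (n := n) a (by simp [ha]), hsel]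
  · rw [htb]
    ext i j
    simp only [frame, hget, decide_eq_true_eq]
  · rw [hta, hsel]
  · rw [htb]
    funext s i
    ext j
    cases s <;> simp only [proposal, hget, Set.mem_ofPred_eq, cond_false, cond_true,
      decide_eq_true_eq]

/-- An unrefuted certificate selects only facets, and their number is exactly `k + d`, which gives
the lower bound; conversely, any `k + d` facets with their witnessing extensions form such a
certificate. -/
theorem atLeastFacets_mem_SigmaP (sem : Semantics) (d : Bool) :
    atLeastFacets sem d ∈ SigmaP 2 := by
  convert mem_SigmaP_two (scanner sem d) using 1
  ext w
  constructor
  · rintro ⟨n, h0, F, k, rfl, hk⟩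
    obtain ⟨S, hSF, hS⟩ := Set.exists_subset_card_eq hk
    choose! X hX using fun i (hi : i ∈ facets sem F) => (mem_facets_iff sem F i).1 hi
    obtain ⟨l, hl, hn, hw, hF, hs, hp⟩ := exists_wellFormed d h0 F k S hS fun s i => X i s
    refine ⟨l, hl, (forall_result_eq_false_iff sem d l hn).2 ⟨hw, ?_⟩⟩
    rw [hF, hs, hp, forall_not_refutes_iff]
    exact fun i hi => hX i (hSF hi)
  · rintro ⟨l, rfl, h⟩
    obtain ⟨hw, hr⟩ := (forall_result_eq_false_iff sem d l rfl).1 h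
    rw [forall_not_refutes_iff] at hr
    refine ⟨_, hw.1, _, _, encodeInstance_frame d l rfl hw, ?_⟩
    rw [hw.2.2.2.2, ← ncard_selection _ rfl]
    refine Set.ncard_le_ncard (fun i hi => ?_) (Set.toFinite _)
    exact (mem_facets_iff _ _ _).2 ⟨fun s => proposal _ _ s i, hr i hi⟩

/-- The complement also contains the words that encode no instance; the first factor removes them.
-/
theorem exactFacets_eq (sem : Semantics) :
    exactFacets sem = atLeastFacets sem false ∩ (atLeastFacets sem true)ᶜ := by
  ext w
  constructor
  · rintro ⟨n, h0, F, k, rfl, hk⟩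
    refine ⟨⟨n, h0, F, k, rfl, by simp [hk]⟩, ?_⟩
    rintro ⟨n', -, F', k', h, hk'⟩
    obtain ⟨h₁, rfl⟩ := eq_of_encodeInstance_eq h sem
    rw [← h₁, hk] at hk'
    simp at hk'
  · rintro ⟨⟨n, h0, F, k, rfl, hk⟩, h⟩
    refine ⟨n, h0, F, k, rfl, ?_⟩
    by_contra hne
    refine h ⟨n, h0, F, k, rfl, ?_⟩
    simp only [Bool.toNat_false, Bool.toNat_true] at hk ⊢
    omega

end Argumentation

theorem mainTheorem9 (sem : Argumentation.Semantics) :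
    Argumentation.exactFacets sem ∈ Complexity.DP 2 := by
  refine ⟨_, Argumentation.atLeastFacets_mem_SigmaP sem false, _, ?_,
    Argumentation.exactFacets_eq sem⟩
  simpa [Complexity.PiP] using Argumentation.atLeastFacets_mem_SigmaP sem true
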